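/- Let $n\ge 1$, let $\Omega\subset\mathbb R^n$ be a bounded open set (for instance a bounded Lipschitz domain), and let $s\in(0,1]$. Let $G:[0,\infty)\to[0,\infty)$ be a Young function, i.e. $G(0)=0$ and $G'=g$ on $[0,\infty)$ (one-sided at $0$), where $g$ is right-continuous and non-decreasing, $g(0)=0$, $g>0$ on $(0,\infty)$ and $g(t)\to\infty$ as $t\to\infty$. Assume that there are constants $1<p^-<p^+<\infty$ with $$p^-\le \frac{t\,g(t)}{G(t)}\le p^+\qquad\text{for all } t>0 .$$ Put $D_su(x,y)=\frac{u(x)-u(y)}{|x-y|^s}$, $d\mu=\frac{dx\,dy}{|x-y|^n}$, and let $$\|u\|_G=\inf\Big\{\tau>0:\int_\Omega G\big(\tfrac{|u|}{\tau}\big)dx\le 1\Big\},\qquad [u]_{s,G}=\inf\Big\{\tau>0:(1-s)\iint_{\mathbb R^n\times\mathbb R^n}G\big(\tfrac{|D_su|}{\tau}\big)d\mu\le 1\Big\}\quad(0<s<1).$$ Let $\mathcal H_s(u)=[u]_{s,G}$ if $s\in(0,1)$ and $\mathcal H_1(u)=\|\nabla u\|_G=\|\,|\nabla u|\,\|_G$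 with the weak gradient. Let $W^{s,G}_0(\Omega)$ be the closure of $C_c^\infty(\Omega)$, whose elements are extended by zero to $\mathbb R^n$, with respect to the norm $\|u\|_{s,G}=\|u\|_G+\mathcal H_s(u)$, and let $\mathcal J_s(u)=\mathcal H_s(u)/\|u\|_G$ for $u\ne0$. Let $u\in W^{s,G}_0(\Omega)$, $u\neq 0$. Then $u$ is a critical point of $\mathcal J_s$ (that is, $\mathcal J_s$ is Fréchet differentiable at $u$ on $W^{s,G}_0(\Omega)$ with $\mathcal J_s'(u)=0$) if and only if there is $\lambda\in\mathbb R$ such that $u$ is a weak solution of $$\mathcal L_su=\lambda\, g\Big(\frac{|u|}{\|u\|_G}\Big)\frac{u}{|u|}\ \text{ in }\Omega,\qquad u=0\ \text{ in }\mathbb R^n\setminus\Omega,$$ that is, for all $v\in W^{s,G}_0(\Omega)$ the integrals below converge absolutely and $$\langle\mathcal L_su,v\rangle=\lambda\int_\Omega g\Big(\frac{|u|}{\|u\|_G}\Big)\frac{u}{|u|}\,v\,dx ,$$ where $$\langle\mathcal L_su,v\rangle=\begin{cases}(1-s)\displaystyle\iint_{\mathbb R^n\times\mathbb R^n}g\Big(\frac{|D_su|}{[u]_{s,G}}\Big)\frac{D_su}{|D_su|}\,D_sv\,d\mu,&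 s\in(0,1),\\[2mm]\displaystyle\int_\Omega g\Big(\frac{|\nabla u|}{\|\nabla u\|_G}\Big)\frac{\nabla u\cdot\nabla v}{|\nabla u|}\,dx,& s=1,\end{cases}$$ and the quotients $\frac{u}{|u|}$, $\frac{D_su}{|D_su|}$, $\frac{\nabla u}{|\nabla u|}$ are read as $0$ where their numerators vanish. -/

import Mathlib

open scoped ContDiff ENNReal

namespace FracOrlicz

noncomputable section

/-- `G : [0,∞) → [0,∞)` is a Young function with derivative `g` (only the values on `[0,∞)` of the
two functions matter): `G' = g` on `[0,∞)` (one-sided at `0`), where `g` is right-continuous,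
non-decreasing, positive on `(0,∞)`, vanishes at `0` and diverges at infinity. -/
structure IsYoungFunction (G g : ℝ → ℝ) : Prop where
  nonneg : ∀ t, 0 ≤ t → 0 ≤ G t
  map_zero : G 0 = 0
  hasDeriv : ∀ t, 0 ≤ t → HasDerivWithinAt G (g t) (Set.Ici 0) t
  deriv_rightCont : ∀ t, 0 ≤ t → ContinuousWithinAt g (Set.Ici t) t
  deriv_zero : g 0 = 0
  deriv_pos : ∀ t, 0 < t → 0 < g t
  deriv_mono : MonotoneOn g (Set.Ici 0)
  deriv_atTop : Filter.Tendsto g Filter.atTop Filter.atTop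

/-- The growth condition `p⁻ ≤ t g(t) / G(t) ≤ p⁺` for `t > 0`, where `1 < p⁻ < p⁺ < ∞`. -/
structure GrowthBounds (G g : ℝ → ℝ) (pm pp : ℝ) : Prop where
  one_lt : 1 < pm
  lt : pm < pp
  lower : ∀ t, 0 < t → pm ≤ t * g t / G t
  upper : ∀ t, 0 < t → t * g t / G t ≤ pp

section Orlicz

variable {α F : Type*} [MeasurableSpace α] [NormedAddCommGroup F] [NormedSpace ℝ F]

/-- The modular `∫ G(|f|) dν`, with values in `[0,∞]`. -/
def modular (G : ℝ → ℝ) (ν : MeasureTheory.Measure α) (f : α → F) : ℝ≥0∞ :=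
  ∫⁻ x, ENNReal.ofReal (G ‖f x‖) ∂ν

/-- The Luxemburg norm `inf {τ > 0 : ∫ G(|f| / τ) dν ≤ 1}`. -/
def luxemburg (G : ℝ → ℝ) (ν : MeasureTheory.Measure α) (f : α → F) : ℝ :=
  sInf {τ : ℝ | 0 < τ ∧ modular G ν (fun x => τ⁻¹ • f x) ≤ 1}

/-- Membership in the Orlicz class `L^G(ν)`: measurable with finite modular. -/
def MemOrlicz (G : ℝ → ℝ) (ν : MeasureTheory.Measure α) (f : α → F) : Prop :=
  MeasureTheory.AEStronglyMeasurable f ν ∧ modular G ν f < ⊤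

end Orlicz

variable {n : ℕ}

/-- Test functions: `φ ∈ C_c^∞(Ω)`, extended by zero to the whole space. -/
structure IsTestFunction (Ω : Set (EuclideanSpace ℝ (Fin n)))
    (φ : EuclideanSpace ℝ (Fin n) → ℝ) : Prop where
  smooth : ContDiff ℝ ∞ φ
  compact_supp : HasCompactSupport φ
  supp_subset : tsupport φ ⊆ Ω

/-- `F` is a weak (distributional) gradient of `u` in `Ω`:
`∫_Ω u ∂_w φ = - ∫_Ω (F · w) φ` for all `φ ∈ C_c^∞(Ω)` and all directions `w`. -/
structure IsWeakGradient (Ω : Set (EuclideanSpace ℝ (Fin n)))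
    (u : EuclideanSpace ℝ (Fin n) → ℝ)
    (F : EuclideanSpace ℝ (Fin n) → EuclideanSpace ℝ (Fin n)) : Prop where
  locInt : MeasureTheory.LocallyIntegrableOn u Ω
  locInt_grad : MeasureTheory.LocallyIntegrableOn F Ω
  integral_eq : ∀ φ : EuclideanSpace ℝ (Fin n) → ℝ, IsTestFunction Ω φ →
    ∀ w : EuclideanSpace ℝ (Fin n),
      ∫ x in Ω, u x * fderiv ℝ φ x w = - ∫ x in Ω, inner ℝ (F x) w * φ x

open Classical in
/-- The weak gradient `∇u` in `Ω`; it is unique up to null sets in `Ω` when it exists. -/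
def weakGrad (Ω : Set (EuclideanSpace ℝ (Fin n))) (u : EuclideanSpace ℝ (Fin n) → ℝ) :
    EuclideanSpace ℝ (Fin n) → EuclideanSpace ℝ (Fin n) :=
  if h : ∃ F, IsWeakGradient Ω u F then h.choose else 0

/-- The Hölder quotient `D_s u (x, y) = (u x - u y) / |x - y|^s`. -/
def holderQuot (s : ℝ) (u : EuclideanSpace ℝ (Fin n) → ℝ)
    (p : EuclideanSpace ℝ (Fin n) × EuclideanSpace ℝ (Fin n)) : ℝ :=
  (u p.1 - u p.2) / ‖p.1 - p.2‖ ^ s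

/-- The measure `dμ = |x - y|^{-n} dx dy` on `ℝⁿ × ℝⁿ`. -/
def gagliardoMeasure (n : ℕ) :
    MeasureTheory.Measure (EuclideanSpace ℝ (Fin n) × EuclideanSpace ℝ (Fin n)) :=
  MeasureTheory.volume.withDensity (fun p => ENNReal.ofReal ((‖p.1 - p.2‖ ^ n)⁻¹))

/-- The Luxemburg norm `‖u‖_G` of `L^G(Ω)`. -/
def normG (G : ℝ → ℝ) (Ω : Set (EuclideanSpace ℝ (Fin n)))
    (u : EuclideanSpace ℝ (Fin n) → ℝ) : ℝ :=
  luxemburg G (MeasureTheory.volume.restrict Ω) u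

/-- The Gagliardo seminorm `[u]_{s,G}`, whose modular is `(1-s) ∬ G(|D_s u|) dμ`. -/
def gagliardo (G : ℝ → ℝ) (s : ℝ) (u : EuclideanSpace ℝ (Fin n) → ℝ) : ℝ :=
  luxemburg G (ENNReal.ofReal (1 - s) • gagliardoMeasure n) (holderQuot s u)

/-- The functional `H_s`: `[u]_{s,G}` if `s ≠ 1`, and `‖∇u‖_G` if `s = 1`. -/
def energy (G : ℝ → ℝ) (s : ℝ) (Ω : Set (EuclideanSpace ℝ (Fin n)))
    (u : EuclideanSpace ℝ (Fin n) → ℝ) : ℝ :=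
  if s = 1 then luxemburg G (MeasureTheory.volume.restrict Ω) (weakGrad Ω u)
  else gagliardo G s u

/-- Finiteness of the modular that defines `H_s`; for `s = 1` this means that `u` has a weak
gradient in `Ω` which belongs to `L^G(Ω; ℝⁿ)`. -/
def HasFiniteEnergy (G : ℝ → ℝ) (s : ℝ) (Ω : Set (EuclideanSpace ℝ (Fin n)))
    (u : EuclideanSpace ℝ (Fin n) → ℝ) : Prop :=
  if s = 1 then ∃ F, IsWeakGradient Ω u F ∧ MemOrlicz G (MeasureTheory.volume.restrict Ω) F
  else modular G (ENNReal.ofReal (1 - s) • gagliardoMeasure n) (holderQuot s u) < ⊤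

/-- The norm `‖u‖_{s,G} = ‖u‖_G + H_s(u)` of `W^{s,G}_0(Ω)`. -/
def normW (G : ℝ → ℝ) (s : ℝ) (Ω : Set (EuclideanSpace ℝ (Fin n)))
    (u : EuclideanSpace ℝ (Fin n) → ℝ) : ℝ :=
  normG G Ω u + energy G s Ω u

/-- `u ∈ W^{s,G}_0(Ω)`, the closure of `C_c^∞(Ω)` in the fractional Orlicz-Sobolev space (in the
Orlicz-Sobolev space `W^{1,G}` if `s = 1`). Functions are defined on the whole space and vanish
almost everywhere outside `Ω`. -/
structure MemW0 (G : ℝ → ℝ) (s : ℝ) (Ω : Set (EuclideanSpace ℝ (Fin n)))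
    (u : EuclideanSpace ℝ (Fin n) → ℝ) : Prop where
  aesm : MeasureTheory.AEStronglyMeasurable u MeasureTheory.volume
  ae_zero : ∀ᵐ x ∂(MeasureTheory.volume.restrict Ωᶜ), u x = 0
  memOrlicz : MemOrlicz G (MeasureTheory.volume.restrict Ω) u
  finiteEnergy : HasFiniteEnergy G s Ω u
  approx : ∀ ε : ℝ, 0 < ε → ∃ φ : EuclideanSpace ℝ (Fin n) → ℝ,
    IsTestFunction Ω φ ∧ normW G s Ω (u - φ) < ε

/-- The Rayleigh quotient `J_s(u) = H_s(u) / ‖u‖_G`. -/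
def rayleigh (G : ℝ → ℝ) (s : ℝ) (Ω : Set (EuclideanSpace ℝ (Fin n)))
    (u : EuclideanSpace ℝ (Fin n) → ℝ) : ℝ :=
  energy G s Ω u / normG G Ω u

/-- `u` is a critical point of `J_s` on `W^{s,G}_0(Ω)`: the functional `J_s` is Fréchet
differentiable at `u` with respect to the norm of `W^{s,G}_0(Ω)`, and its derivative there is
zero, that is, `J_s(u + v) - J_s(u) = o(‖v‖_{s,G})` as `v → 0` in `W^{s,G}_0(Ω)`. -/
def IsCriticalPoint (G : ℝ → ℝ) (s : ℝ) (Ω : Set (EuclideanSpace ℝ (Fin n)))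
    (u : EuclideanSpace ℝ (Fin n) → ℝ) : Prop :=
  ∀ ε : ℝ, 0 < ε → ∃ δ : ℝ, 0 < δ ∧ ∀ v : EuclideanSpace ℝ (Fin n) → ℝ,
    MemW0 G s Ω v → normW G s Ω v < δ →
      |rayleigh G s Ω (u + v) - rayleigh G s Ω u| ≤ ε * normW G s Ω v

/-- The integrand of `⟨L_s u, v⟩` for `0 < s < 1`. -/
def fracIntegrand (G g : ℝ → ℝ) (s : ℝ) (u v : EuclideanSpace ℝ (Fin n) → ℝ)
    (p : EuclideanSpace ℝ (Fin n) × EuclideanSpace ℝ (Fin n)) : ℝ :=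
  g (|holderQuot s u p| / gagliardo G s u) * (holderQuot s u p / |holderQuot s u p|)
    * holderQuot s v p

/-- The integrand of `⟨L_1 u, v⟩`. -/
def localIntegrand (G g : ℝ → ℝ) (Ω : Set (EuclideanSpace ℝ (Fin n)))
    (u v : EuclideanSpace ℝ (Fin n) → ℝ) (x : EuclideanSpace ℝ (Fin n)) : ℝ :=
  g (‖weakGrad Ω u x‖ / luxemburg G (MeasureTheory.volume.restrict Ω) (weakGrad Ω u))
    * (inner ℝ (weakGrad Ω u x) (weakGrad Ω v x) / ‖weakGrad Ω u x‖)

/-- The integrand `g(|u| / ‖u‖_G) (u / |u|) v` of the right-hand side; as for the other integrands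
the quotient `u / |u|` is `0` where `u = 0`. -/
def rhsIntegrand (G g : ℝ → ℝ) (Ω : Set (EuclideanSpace ℝ (Fin n)))
    (u v : EuclideanSpace ℝ (Fin n) → ℝ) (x : EuclideanSpace ℝ (Fin n)) : ℝ :=
  g (|u x| / normG G Ω u) * (u x / |u x|) * v x

/-- The integral that defines `⟨L_s u, v⟩` converges absolutely. -/
def PairingIntegrable (G g : ℝ → ℝ) (s : ℝ) (Ω : Set (EuclideanSpace ℝ (Fin n)))
    (u v : EuclideanSpace ℝ (Fin n) → ℝ) : Prop :=
  if s = 1 then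
    MeasureTheory.Integrable (localIntegrand G g Ω u v) (MeasureTheory.volume.restrict Ω)
  else MeasureTheory.Integrable (fracIntegrand G g s u v) (gagliardoMeasure n)

/-- The duality pairing `⟨L_s u, v⟩`. -/
def pairing (G g : ℝ → ℝ) (s : ℝ) (Ω : Set (EuclideanSpace ℝ (Fin n)))
    (u v : EuclideanSpace ℝ (Fin n) → ℝ) : ℝ :=
  if s = 1 then ∫ x in Ω, localIntegrand G g Ω u v x
  else (1 - s) * ∫ p, fracIntegrand G g s u v p ∂(gagliardoMeasure n)

/-- `u` is a weak solution of `L_s u = lam * g(|u| / ‖u‖_G) u / |u|` in `Ω`: the two sides agree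
when tested against every `v ∈ W^{s,G}_0(Ω)`. The boundary condition `u = 0` outside `Ω` is part of
`u ∈ W^{s,G}_0(Ω)`. -/
def IsWeakSolution (G g : ℝ → ℝ) (s : ℝ) (Ω : Set (EuclideanSpace ℝ (Fin n))) (lam : ℝ)
    (u : EuclideanSpace ℝ (Fin n) → ℝ) : Prop :=
  ∀ v : EuclideanSpace ℝ (Fin n) → ℝ, MemW0 G s Ω v →
    PairingIntegrable G g s Ω u v ∧
    MeasureTheory.Integrable (rhsIntegrand G g Ω u v) (MeasureTheory.volume.restrict Ω) ∧
    pairing G g s Ω u v = lam * ∫ x in Ω, rhsIntegrand G g Ω u v x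

end

end FracOrlicz

/-! Both terms of the Rayleigh quotient are Luxemburg norms of images of `u` under maps that are
linear up to null sets: the identity for the denominator, the Hölder quotient or the weak gradient
for the numerator. Everything rests on one abstract fact: on an Orlicz space with the growth bounds,
the Luxemburg norm is Fréchet differentiable at every nonzero `f`. With `N` the norm of `f`, its
derivative in direction `h` is `∫ g(|f|/N) (f/|f|)·h` divided by `∫ g(|f|/N) |f|/N`
(`luxemburg_frechet`).

This is proved first for the modular (`integral_taylorRem_isLittleO`): where the perturbation
dominates `f`, the bound `p⁻ > 1` makes the remainder small against the modular of the perturbation;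
elsewhere a multiple of `G(2|f|)` dominates it, so dominated convergence applies. Since a nonzero
function divided by its norm has modular exactly one (`modular_luxemburg`), the expansion passes to
the norm by testing scalings on either side of the predicted value
(`luxemburg_expansion_of_modular_eq_one`).

Let `H`, `N` be the two norms of `u` and `A`, `B` their derivatives. By the quotient rule `u` is
critical iff `N A(v) = H B(v)` for all `v` (`isCriticalPoint_iff_deriv`). Writing `A = P/a` and `B =
R/b`, with `P` and `R` the integrals of the weak equation up to the multiplier, this is `P = λR`
with `λ = Ha/(Nb)`. Conversely, testing a weak solution with `v = u` forces this value of `λ`,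
because `P(u) = Ha` and `R(u) = Nb`.

Differentiability requires the image of `u` to be nonzero. For `s = 1` this follows from an `L¹`
Poincaré inequality for test functions and density; for `s < 1`, a vanishing Hölder quotient makes
`u` almost everywhere constant, and `u` vanishes outside a bounded set. -/

namespace FracOrlicz

/-! ### Growth and comparison estimates for the Young function -/

section Scalar

variable {G g : ℝ → ℝ} {pm pp : ℝ}

theorem GrowthBounds.G_pos (hG : IsYoungFunction G g) (hp : GrowthBounds G g pm pp) {t : ℝ}
    (ht : 0 < t) : 0 < G t := by
  refine lt_of_le_of_ne (hG.nonneg t ht.le) fun h => ?_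
  have h1 := hp.lower t ht
  -- If `G t = 0` the quotient takes the default value `0`, which contradicts the lower bound `pm >
  -- 1`.
  rw [← h, div_zero] at h1
  linarith [hp.one_lt]

theorem GrowthBounds.lower_mul (hG : IsYoungFunction G g) (hp : GrowthBounds G g pm pp) {t : ℝ}
    (ht : 0 ≤ t) : pm * G t ≤ t * g t := by
  rcases ht.eq_or_lt with rfl | h
  · simp [hG.map_zero]
  · exact (le_div_iff₀ (hp.G_pos hG h)).1 (hp.lower t h)

theorem GrowthBounds.upper_mul (hG : IsYoungFunction G g) (hp : GrowthBounds G g pm pp) {t : ℝ}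
    (ht : 0 ≤ t) : t * g t ≤ pp * G t := by
  rcases ht.eq_or_lt with rfl | h
  · simp [hG.map_zero]
  · exact (div_le_iff₀ (hp.G_pos hG h)).1 (hp.upper t h)

theorem IsYoungFunction.hasDerivAt (hG : IsYoungFunction G g) {t : ℝ} (ht : 0 < t) :
    HasDerivAt G (g t) t :=
  (hG.hasDeriv t ht.le).hasDerivAt (Ici_mem_nhds ht)

theorem IsYoungFunction.continuousOn (hG : IsYoungFunction G g) : ContinuousOn G (Set.Ici 0) :=
  fun t ht => (hG.hasDeriv t ht).continuousWithinAt

theorem IsYoungFunction.deriv_nonneg (hG : IsYoungFunction G g) {t : ℝ} (ht : 0 ≤ t) :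
    0 ≤ g t := by
  rcases ht.eq_or_lt with rfl | h
  · exact hG.deriv_zero.ge
  · exact (hG.deriv_pos t h).le

/-- Mean value theorem, with the intermediate slope bounded by monotonicity of `g`. -/
theorem IsYoungFunction.sub_nonneg_and_le (hG : IsYoungFunction G g) {a b : ℝ} (ha : 0 ≤ a)
    (hab : a ≤ b) : 0 ≤ G b - G a ∧ G b - G a ≤ (b - a) * g b := by
  rcases hab.eq_or_lt with rfl | h
  · simp
  obtain ⟨c, hc, hc'⟩ := exists_hasDerivAt_eq_slope G g h
    (hG.continuousOn.mono fun x hx => ha.trans hx.1)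
    (fun x hx => hG.hasDerivAt (ha.trans_lt hx.1))
  have hba : 0 < b - a := sub_pos.2 h
  have hc0 : 0 ≤ c := ha.trans hc.1.le
  have e : G b - G a = (b - a) * g c := by rw [hc']; field_simp
  rw [e]
  exact ⟨mul_nonneg hba.le (hG.deriv_nonneg hc0),
    mul_le_mul_of_nonneg_left (hG.deriv_mono hc0 (ha.trans hab) hc.2.le) hba.le⟩

theorem IsYoungFunction.mono (hG : IsYoungFunction G g) : MonotoneOn G (Set.Ici 0) :=
  fun _ ha _ _ hab => sub_nonneg.1 (hG.sub_nonneg_and_le ha hab).1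

theorem IsYoungFunction.abs_sub_le (hG : IsYoungFunction G g) {a b c : ℝ} (ha : 0 ≤ a)
    (hb : 0 ≤ b) (hac : a ≤ c) (hbc : b ≤ c) : |G a - G b| ≤ |a - b| * g c := by
  wlog hab : b ≤ a generalizing a b
  · rw [abs_sub_comm, abs_sub_comm a]
    exact this hb ha hbc hac (le_of_not_ge hab)
  have h := hG.sub_nonneg_and_le hb hab
  rw [abs_of_nonneg h.1, abs_of_nonneg (sub_nonneg.2 hab)]
  exact h.2.trans (mul_le_mul_of_nonneg_left (hG.deriv_mono ha (ha.trans hac) hac)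
    (sub_nonneg.2 hab))

/-- The derivative is `t ^ (-pm - 1) * (t g(t) - pm G(t))`, nonnegative by the lower growth bound.
-/
theorem GrowthBounds.monotoneOn_div (hG : IsYoungFunction G g) (hp : GrowthBounds G g pm pp) :
    MonotoneOn (fun t => G t * t ^ (-pm)) (Set.Ioi 0) := by
  have hd : ∀ t ∈ Set.Ioi (0 : ℝ), HasDerivAt (fun t => G t * t ^ (-pm))
      (g t * t ^ (-pm) + G t * (-pm * t ^ (-pm - 1))) t := fun t ht =>
    (hG.hasDerivAt ht).mul (Real.hasDerivAt_rpow_const (Or.inl (ne_of_gt ht)))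
  refine monotoneOn_of_deriv_nonneg (convex_Ioi 0)
    (fun t ht => (hd t ht).continuousAt.continuousWithinAt)
    (fun t ht => (hd t (interior_subset ht)).differentiableAt.differentiableWithinAt) ?_
  intro t ht
  have ht : 0 < t := interior_subset ht
  rw [(hd t ht).deriv]
  have e : t ^ (-pm) = t ^ (-pm - 1) * t := by
    rw [Real.rpow_sub_one ht.ne']; field_simp
  rw [e]
  have h1 : 0 < t ^ (-pm - 1) := Real.rpow_pos_of_pos ht _
  nlinarith [hp.lower_mul hG ht.le]

theorem GrowthBounds.antitoneOn_div (hG : IsYoungFunction G g) (hp : GrowthBounds G g pm pp) :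
    AntitoneOn (fun t => G t * t ^ (-pp)) (Set.Ioi 0) := by
  have hd : ∀ t ∈ Set.Ioi (0 : ℝ), HasDerivAt (fun t => G t * t ^ (-pp))
      (g t * t ^ (-pp) + G t * (-pp * t ^ (-pp - 1))) t := fun t ht =>
    (hG.hasDerivAt ht).mul (Real.hasDerivAt_rpow_const (Or.inl (ne_of_gt ht)))
  refine antitoneOn_of_deriv_nonpos (convex_Ioi 0)
    (fun t ht => (hd t ht).continuousAt.continuousWithinAt)
    (fun t ht => (hd t (interior_subset ht)).differentiableAt.differentiableWithinAt) ?_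
  intro t ht
  have ht : 0 < t := interior_subset ht
  rw [(hd t ht).deriv]
  have e : t ^ (-pp) = t ^ (-pp - 1) * t := by
    rw [Real.rpow_sub_one ht.ne']; field_simp
  rw [e]
  have h1 : 0 < t ^ (-pp - 1) := Real.rpow_pos_of_pos ht _
  nlinarith [hp.upper_mul hG ht.le]

/-- `G (c t) ≤ c ^ p⁻ G t` for `c ≤ 1`. -/
theorem GrowthBounds.map_mul_le_of_le_one (hG : IsYoungFunction G g)
    (hp : GrowthBounds G g pm pp) {c t : ℝ} (hc : 0 < c) (hc1 : c ≤ 1) (ht : 0 ≤ t) :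
    G (c * t) ≤ c ^ pm * G t := by
  rcases ht.eq_or_lt with rfl | ht
  · simp [hG.map_zero]
  have h := hp.monotoneOn_div hG (Set.mem_Ioi.2 (mul_pos hc ht)) (Set.mem_Ioi.2 ht)
    (mul_le_of_le_one_left ht.le hc1)
  simp only [Real.mul_rpow hc.le ht.le, Real.rpow_neg hc.le] at h
  have h1 : 0 < t ^ (-pm) := Real.rpow_pos_of_pos ht _
  have h2 : 0 < c ^ pm := Real.rpow_pos_of_pos hc _
  rw [← mul_assoc] at h
  have h := le_of_mul_le_mul_right h h1
  rwa [mul_inv_le_iff₀ h2, mul_comm (G t)] at h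

/-- `G (c t) ≤ c ^ p⁺ G t` for `1 ≤ c`. -/
theorem GrowthBounds.map_mul_le_of_one_le (hG : IsYoungFunction G g)
    (hp : GrowthBounds G g pm pp) {c t : ℝ} (hc1 : 1 ≤ c) (ht : 0 ≤ t) :
    G (c * t) ≤ c ^ pp * G t := by
  have hc : 0 < c := zero_lt_one.trans_le hc1
  rcases ht.eq_or_lt with rfl | ht
  · simp [hG.map_zero]
  have h := hp.antitoneOn_div hG (Set.mem_Ioi.2 ht) (Set.mem_Ioi.2 (mul_pos hc ht))
    (le_mul_of_one_le_left ht.le hc1)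
  simp only [Real.mul_rpow hc.le ht.le, Real.rpow_neg hc.le] at h
  have h1 : 0 < t ^ (-pp) := Real.rpow_pos_of_pos ht _
  have h2 : 0 < c ^ pp := Real.rpow_pos_of_pos hc _
  rw [← mul_assoc] at h
  have h := le_of_mul_le_mul_right h h1
  rwa [mul_inv_le_iff₀ h2, mul_comm (G t)] at h

/-- This plays the role of convexity together with `G 0 = 0`, but follows directly from `pm > 1`. -/
theorem GrowthBounds.map_mul_le_mul (hG : IsYoungFunction G g)
    (hp : GrowthBounds G g pm pp) {c t : ℝ} (hc : 0 < c) (hc1 : c ≤ 1) (ht : 0 ≤ t) :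
    G (c * t) ≤ c * G t := by
  refine (hp.map_mul_le_of_le_one hG hc hc1 ht).trans
    (mul_le_mul_of_nonneg_right ?_ (hG.nonneg t ht))
  simpa using Real.rpow_le_rpow_of_exponent_ge hc hc1 hp.one_lt.le

/-- Monotonicity suffices: the mean is at most the larger of the two arguments. -/
theorem IsYoungFunction.map_half_add_le (hG : IsYoungFunction G g) {a b : ℝ} (ha : 0 ≤ a)
    (hb : 0 ≤ b) : G (2⁻¹ * (a + b)) ≤ G a + G b := by
  rcases le_total a b with h | h
  · have := hG.mono (Set.mem_Ici.2 (by positivity)) hb (show 2⁻¹ * (a + b) ≤ b by linarith)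
    linarith [hG.nonneg a ha]
  · have := hG.mono (Set.mem_Ici.2 (by positivity)) ha (show 2⁻¹ * (a + b) ≤ a by linarith)
    linarith [hG.nonneg b hb]

theorem GrowthBounds.map_quarter_add_le (hG : IsYoungFunction G g)
    (hp : GrowthBounds G g pm pp) {a b : ℝ} (ha : 0 ≤ a) (hb : 0 ≤ b) :
    G (4⁻¹ * (a + b)) ≤ 2⁻¹ * (G a + G b) := by
  have h := hp.map_mul_le_mul hG (c := 2⁻¹) (by norm_num) (by norm_num)
    (t := 2⁻¹ * (a + b)) (by positivity)
  rw [← mul_assoc] at h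
  norm_num at h
  have := hG.map_half_add_le ha hb
  norm_num at this ⊢
  linarith

theorem GrowthBounds.map_add_le (hG : IsYoungFunction G g)
    (hp : GrowthBounds G g pm pp) {a b : ℝ} (ha : 0 ≤ a) (hb : 0 ≤ b) :
    G (a + b) ≤ 2 ^ pp * (G a + G b) := by
  have h := hp.map_mul_le_of_one_le hG (c := 2) (by norm_num) (t := 2⁻¹ * (a + b)) (by positivity)
  rw [← mul_assoc] at h
  norm_num at h
  refine h.trans (mul_le_mul_of_nonneg_left ?_ (by positivity))
  have := hG.map_half_add_le ha hb
  norm_num at this ⊢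
  exact this

/-- A substitute for Young's inequality that avoids the conjugate function: replace the smaller
argument by the larger one and use `t g(t) ≤ pp G(t)`. -/
theorem GrowthBounds.deriv_mul_le (hG : IsYoungFunction G g)
    (hp : GrowthBounds G g pm pp) {a b : ℝ} (ha : 0 ≤ a) (hb : 0 ≤ b) :
    g a * b ≤ pp * (G a + G b) := by
  have hpp : 0 < pp := by linarith [hp.one_lt, hp.lt]
  rcases le_total a b with h | h
  · have h1 := mul_le_mul_of_nonneg_right (hG.deriv_mono ha hb h) hb
    nlinarith [hp.upper_mul hG hb, hG.nonneg a ha]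
  · have h1 := mul_le_mul_of_nonneg_left h (hG.deriv_nonneg ha)
    nlinarith [hp.upper_mul hG ha, hG.nonneg b hb]

/-- A Young function grows at least linearly. -/
theorem GrowthBounds.le_add (hG : IsYoungFunction G g) (hp : GrowthBounds G g pm pp) {t : ℝ}
    (ht : 0 ≤ t) : t ≤ 1 + (G 1)⁻¹ * G t := by
  have h1 := hp.G_pos hG one_pos
  rcases le_total t 1 with h | h
  · have := mul_nonneg (inv_nonneg.2 h1.le) (hG.nonneg t ht)
    linarith
  · have h0 : 0 < t := by linarith
    have h2 := hp.map_mul_le_mul hG (inv_pos.2 h0) (inv_le_one_of_one_le₀ h) ht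
    rw [inv_mul_cancel₀ h0.ne', ← div_eq_inv_mul, le_div_iff₀ h0] at h2
    have : t ≤ (G 1)⁻¹ * G t := by
      rw [← div_eq_inv_mul, le_div_iff₀ h1]; linarith
    linarith

end Scalar

/-! ### Modular and Luxemburg norm -/

section Luxemburg

open MeasureTheory Filter Topology

variable {α F : Type*} [MeasurableSpace α] [NormedAddCommGroup F]
  {G g : ℝ → ℝ} {pm pp : ℝ} {ν : Measure α} {f h : α → F}

/-- Precomposing with `max · 0` makes `k` monotone on the whole line, hence Borel; no continuity of
`k` is required, so this covers `g` as well as `G`. -/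
theorem aemeasurable_comp_norm {k : ℝ → ℝ} (hk : MonotoneOn k (Set.Ici 0))
    (hf : AEStronglyMeasurable f ν) : AEMeasurable (fun x => k ‖f x‖) ν := by
  have hm : Monotone fun t => k (max t 0) := fun a b hab =>
    hk (Set.mem_Ici.2 (le_max_right _ _)) (Set.mem_Ici.2 (le_max_right _ _))
      (max_le_max_right 0 hab)
  refine (hm.measurable.comp_aemeasurable hf.norm.aemeasurable).congr ?_
  filter_upwards with x
  simp

theorem IsYoungFunction.modular_mono (hG : IsYoungFunction G g) {F' : Type*}
    [NormedAddCommGroup F'] {h : α → F'}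
    (hfh : ∀ x, ‖f x‖ ≤ ‖h x‖) : modular G ν f ≤ modular G ν h :=
  lintegral_mono fun x => ENNReal.ofReal_le_ofReal
    (hG.mono (norm_nonneg _) (norm_nonneg _) (hfh x))

theorem modular_congr_ae (hfh : f =ᵐ[ν] h) : modular G ν f = modular G ν h :=
  lintegral_congr_ae (hfh.mono fun x hx => by simp only [hx])

theorem MemOrlicz.congr_ae (hf : MemOrlicz G ν f) (hfh : f =ᵐ[ν] h) : MemOrlicz G ν h :=
  ⟨hf.1.congr hfh, (modular_congr_ae hfh).symm.trans_lt hf.2⟩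

theorem IsYoungFunction.integrable (hG : IsYoungFunction G g)
    (hf : MemOrlicz G ν f) : Integrable (fun x => G ‖f x‖) ν := by
  refine ⟨(aemeasurable_comp_norm hG.mono hf.1).aestronglyMeasurable, ?_⟩
  rw [hasFiniteIntegral_iff_ofReal (ae_of_all _ fun _ => hG.nonneg _ (norm_nonneg _))]
  exact hf.2

theorem IsYoungFunction.ofReal_integral (hG : IsYoungFunction G g)
    (hf : MemOrlicz G ν f) : ENNReal.ofReal (∫ x, G ‖f x‖ ∂ν) = modular G ν f :=
  ofReal_integral_eq_lintegral_ofReal (hG.integrable hf)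
    (ae_of_all _ fun _ => hG.nonneg _ (norm_nonneg _))

theorem IsYoungFunction.integral_le_one (hG : IsYoungFunction G g)
    (hh : MemOrlicz G ν h) (h1 : modular G ν h ≤ 1) : ∫ x, G ‖h x‖ ∂ν ≤ 1 := by
  rw [← hG.ofReal_integral hh, ENNReal.ofReal_le_one] at h1
  exact h1

theorem GrowthBounds.ae_eq_zero_of_modular_eq_zero (hG : IsYoungFunction G g)
    (hp : GrowthBounds G g pm pp) (hf : AEStronglyMeasurable f ν) (h0 : modular G ν f = 0) :
    f =ᵐ[ν] 0 := by
  have := (lintegral_eq_zero_iff' (aemeasurable_comp_norm hG.mono hf).ennreal_ofReal).1 h0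
  filter_upwards [this] with x hx
  by_contra hne
  have := hp.G_pos hG (norm_pos_iff.2 hne)
  simp only [Pi.zero_apply, ENNReal.ofReal_eq_zero] at hx
  linarith

theorem GrowthBounds.memOrlicz_add (hG : IsYoungFunction G g) (hp : GrowthBounds G g pm pp)
    (hf : MemOrlicz G ν f) (hh : MemOrlicz G ν h) : MemOrlicz G ν (fun x => f x + h x) := by
  refine ⟨hf.1.add hh.1, ?_⟩
  calc modular G ν (fun x => f x + h x)
      ≤ ∫⁻ x, ENNReal.ofReal (2 ^ pp) * (ENNReal.ofReal (G ‖f x‖) + ENNReal.ofReal (G ‖h x‖)) ∂ν := by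
        refine lintegral_mono fun x => ?_
        rw [← ENNReal.ofReal_add (hG.nonneg _ (norm_nonneg _)) (hG.nonneg _ (norm_nonneg _)),
          ← ENNReal.ofReal_mul (by positivity)]
        exact ENNReal.ofReal_le_ofReal ((hG.mono (norm_nonneg _) (Set.mem_Ici.2 (by positivity))
          (norm_add_le _ _)).trans (hp.map_add_le hG (norm_nonneg _) (norm_nonneg _)))
    _ = ENNReal.ofReal (2 ^ pp) * (modular G ν f + modular G ν h) := by
        rw [lintegral_const_mul' _ _ ENNReal.ofReal_ne_top, lintegral_add_left']
        · rfl
        · exact (aemeasurable_comp_norm hG.mono hf.1).ennreal_ofReal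
    _ < ⊤ := ENNReal.mul_lt_top ENNReal.ofReal_lt_top (ENNReal.add_lt_top.2 ⟨hf.2, hh.2⟩)

variable [NormedSpace ℝ F]

theorem luxemburg_congr_ae (hfh : f =ᵐ[ν] h) : luxemburg G ν f = luxemburg G ν h := by
  unfold luxemburg
  congr 1
  ext τ
  have : modular G ν (fun x => τ⁻¹ • f x) = modular G ν (fun x => τ⁻¹ • h x) :=
    modular_congr_ae (hfh.mono fun x hx => by simp only [hx])
  simp only [Set.mem_ofPred_eq, this]

theorem modular_smul_le_of_forall {c d : ℝ} (hc : 0 ≤ c)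
    (H : ∀ t, 0 ≤ t → G (c * t) ≤ d * G t) (hd : 0 ≤ d) :
    modular G ν (fun x => c • f x) ≤ ENNReal.ofReal d * modular G ν f := by
  unfold modular
  rw [← lintegral_const_mul' _ _ ENNReal.ofReal_ne_top]
  refine lintegral_mono fun x => ?_
  rw [← ENNReal.ofReal_mul hd, norm_smul, Real.norm_of_nonneg hc]
  exact ENNReal.ofReal_le_ofReal (H _ (norm_nonneg _))

theorem GrowthBounds.modular_smul_le (hG : IsYoungFunction G g) (hp : GrowthBounds G g pm pp)
    {c : ℝ} (hc : 0 < c) (hc1 : c ≤ 1) :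
    modular G ν (fun x => c • f x) ≤ ENNReal.ofReal c * modular G ν f :=
  modular_smul_le_of_forall hc.le (fun _ ht => hp.map_mul_le_mul hG hc hc1 ht) hc.le

theorem GrowthBounds.modular_smul_le_rpow (hG : IsYoungFunction G g)
    (hp : GrowthBounds G g pm pp) {c : ℝ} (hc : 1 ≤ c) :
    modular G ν (fun x => c • f x) ≤ ENNReal.ofReal (c ^ pp) * modular G ν f :=
  modular_smul_le_of_forall (by linarith) (fun _ ht => hp.map_mul_le_of_one_le hG hc ht)
    (Real.rpow_nonneg (by linarith) _)

theorem GrowthBounds.memOrlicz_smul (hG : IsYoungFunction G g) (hp : GrowthBounds G g pm pp)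
    (hf : MemOrlicz G ν f) (c : ℝ) : MemOrlicz G ν (fun x => c • f x) := by
  refine ⟨hf.1.const_smul c, ?_⟩
  have h1 : modular G ν (fun x => c • f x) ≤ modular G ν (fun x => (max 1 |c|) • f x) :=
    hG.modular_mono fun x => by
      rw [norm_smul, norm_smul, Real.norm_eq_abs, Real.norm_of_nonneg (by positivity)]
      exact mul_le_mul_of_nonneg_right (le_max_right _ _) (norm_nonneg _)
  exact h1.trans_lt ((hp.modular_smul_le_rpow hG (le_max_left _ _)).trans_lt
    (ENNReal.mul_lt_top ENNReal.ofReal_lt_top hf.2))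

theorem luxemburg_bddBelow :
    BddBelow {τ : ℝ | 0 < τ ∧ modular G ν (fun x => τ⁻¹ • f x) ≤ 1} :=
  ⟨0, fun _ h => h.1.le⟩

theorem luxemburg_nonneg : 0 ≤ luxemburg G ν f :=
  Real.sInf_nonneg fun _ h => h.1.le

theorem luxemburg_le {τ : ℝ} (hτ : 0 < τ) (h : modular G ν (fun x => τ⁻¹ • f x) ≤ 1) :
    luxemburg G ν f ≤ τ :=
  csInf_le luxemburg_bddBelow ⟨hτ, h⟩

theorem GrowthBounds.luxemburg_nonempty (hG : IsYoungFunction G g)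
    (hp : GrowthBounds G g pm pp) (hf : modular G ν f < ⊤) :
    {τ : ℝ | 0 < τ ∧ modular G ν (fun x => τ⁻¹ • f x) ≤ 1}.Nonempty := by
  have h1 : 0 < max 1 (modular G ν f).toReal := by positivity
  refine ⟨max 1 (modular G ν f).toReal, h1, ?_⟩
  refine (hp.modular_smul_le hG (inv_pos.2 h1) (inv_le_one_of_one_le₀ (le_max_left _ _))).trans ?_
  rw [← ENNReal.ofReal_toReal (a := modular G ν f) hf.ne,
    ENNReal.toReal_ofReal ENNReal.toReal_nonneg, ← ENNReal.ofReal_mul (inv_nonneg.2 h1.le), ← ENNReal.ofReal_one]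
  refine ENNReal.ofReal_le_ofReal ?_
  rw [inv_mul_le_iff₀ h1, mul_one]
  exact le_max_right _ _

theorem IsYoungFunction.modular_inv_smul_anti (hG : IsYoungFunction G g) {σ τ : ℝ} (hσ : 0 < σ)
    (h : σ ≤ τ) : modular G ν (fun x => τ⁻¹ • f x) ≤ modular G ν (fun x => σ⁻¹ • f x) := by
  refine hG.modular_mono fun x => ?_
  rw [norm_smul, norm_smul, Real.norm_of_nonneg (inv_nonneg.2 (hσ.le.trans h)),
    Real.norm_of_nonneg (inv_nonneg.2 hσ.le)]
  exact mul_le_mul_of_nonneg_right (inv_anti₀ hσ h) (norm_nonneg _)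

theorem GrowthBounds.modular_le_one_of_luxemburg_lt (hG : IsYoungFunction G g)
    (hp : GrowthBounds G g pm pp) (hf : modular G ν f < ⊤) {τ : ℝ}
    (h : luxemburg G ν f < τ) : modular G ν (fun x => τ⁻¹ • f x) ≤ 1 := by
  obtain ⟨σ, hσ, hστ⟩ := exists_lt_of_csInf_lt (hp.luxemburg_nonempty hG hf) h
  exact (hG.modular_inv_smul_anti hσ.1 hστ.le).trans hσ.2

theorem GrowthBounds.le_luxemburg (hG : IsYoungFunction G g)
    (hp : GrowthBounds G g pm pp) (hf : modular G ν f < ⊤) {τ : ℝ}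
    (h : 1 < modular G ν (fun x => τ⁻¹ • f x)) : τ ≤ luxemburg G ν f :=
  le_of_not_gt fun hlt => (hp.modular_le_one_of_luxemburg_lt hG hf hlt).not_gt h

/-- An admissible `τ ≤ 1` satisfies `modular f ≤ τ * modular (f / τ) ≤ τ`, so every admissible `τ`
is at least the minimum of `1` and the modular of `f`, which is positive. -/
theorem GrowthBounds.luxemburg_pos (hG : IsYoungFunction G g)
    (hp : GrowthBounds G g pm pp) (hf : MemOrlicz G ν f) (h0 : ¬ f =ᵐ[ν] 0) :
    0 < luxemburg G ν f := by
  have hm : 0 < (modular G ν f).toReal := ENNReal.toReal_pos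
    (fun h => h0 (hp.ae_eq_zero_of_modular_eq_zero hG hf.1 h)) hf.2.ne
  refine (lt_min one_pos hm).trans_le (le_csInf (hp.luxemburg_nonempty hG hf.2) ?_)
  rintro τ ⟨hτ, h⟩
  rcases le_total τ 1 with h1 | h1
  · refine (min_le_right _ _).trans ?_
    have := hp.modular_smul_le hG (ν := ν) (f := fun x => τ⁻¹ • f x) hτ h1
    simp only [smul_inv_smul₀ hτ.ne'] at this
    exact ENNReal.toReal_le_of_le_ofReal hτ.le
      (this.trans (mul_le_of_le_one_right zero_le h))
  · exact (min_le_left _ _).trans h1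

/-- For `r > 1` the modular at scale `N * r` is at most one and at scale `N / r` exceeds one.
Scaling by `r` costs at most the factor `r ^ pp`, which tends to one as `r` decreases to `1`. -/
theorem GrowthBounds.modular_luxemburg (hG : IsYoungFunction G g)
    (hp : GrowthBounds G g pm pp) (hf : MemOrlicz G ν f) (h0 : ¬ f =ᵐ[ν] 0) :
    modular G ν (fun x => (luxemburg G ν f)⁻¹ • f x) = 1 := by
  have hN := hp.luxemburg_pos hG hf h0
  set N := luxemburg G ν f with hNdef
  have key : ∀ r : ℝ, 0 < r → modular G ν (fun x => r • ((N * r)⁻¹ • f x)) =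
      modular G ν (fun x => N⁻¹ • f x) := by
    intro r hr
    congr 1
    ext x
    rw [smul_smul, mul_inv, mul_comm N⁻¹, mul_inv_cancel_left₀ hr.ne']
  have hlim : Tendsto (fun r : ℝ => ENNReal.ofReal (r ^ pp)) (𝓝[>] 1) (𝓝 1) := by
    have : ContinuousAt (fun r : ℝ => ENNReal.ofReal (r ^ pp)) 1 :=
      ENNReal.continuous_ofReal.continuousAt.comp
        (Real.continuousAt_rpow_const _ _ (Or.inl one_ne_zero))
    have := this.tendsto
    simp only [Real.one_rpow, ENNReal.ofReal_one] at this
    exact this.mono_left nhdsWithin_le_nhds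
  apply le_antisymm
  · refine ge_of_tendsto hlim ?_
    filter_upwards [self_mem_nhdsWithin] with r hr
    have hr : 1 < r := hr
    rw [← key r (by linarith)]
    refine (hp.modular_smul_le_rpow hG hr.le).trans (mul_le_of_le_one_right zero_le ?_)
    exact hp.modular_le_one_of_luxemburg_lt hG hf.2 (lt_mul_of_one_lt_right hN hr)
  · have hfin := (hp.memOrlicz_smul hG hf N⁻¹).2
    have h2 := ENNReal.Tendsto.mul_const (b := modular G ν (fun x => N⁻¹ • f x)) hlim
      (Or.inr hfin.ne)
    rw [one_mul] at h2
    refine ge_of_tendsto h2 ?_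
    filter_upwards [self_mem_nhdsWithin] with r hr
    have hr : 1 < r := hr
    refine le_trans ?_ (hp.modular_smul_le_rpow hG hr.le)
    have hr0 : 0 < r := by linarith
    have hnot : ¬ modular G ν (fun x => (N / r)⁻¹ • f x) ≤ 1 := fun hle =>
      (luxemburg_le (div_pos hN hr0) hle).not_gt (div_lt_self hN hr)
    refine (lt_of_not_ge hnot).le.trans (le_of_eq ?_)
    congr 1
    ext x
    rw [smul_smul, inv_div, div_eq_mul_inv]

theorem luxemburg_smul {c : ℝ} (hc : c ≠ 0) :
    luxemburg G ν (fun x => c • f x) = |c| * luxemburg G ν f := by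
  have hc' : 0 < |c| := abs_pos.2 hc
  have hmod : ∀ τ : ℝ, modular G ν (fun x => τ⁻¹ • c • f x) =
      modular G ν (fun x => (|c|⁻¹ * τ)⁻¹ • f x) := by
    intro τ
    unfold modular
    refine lintegral_congr fun x => ?_
    simp only [norm_smul, norm_mul, norm_inv, mul_inv, inv_inv, Real.norm_eq_abs, abs_abs]
    congr 2
    ring
  unfold luxemburg
  rw [← smul_eq_mul, ← Real.sInf_smul_of_nonneg hc'.le]
  congr 1
  ext τ
  rw [Set.mem_smul_set_iff_inv_smul_mem₀ hc'.ne']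
  simp only [Set.mem_ofPred_eq, smul_eq_mul, hmod]
  rw [mul_pos_iff_of_pos_left (inv_pos.2 hc')]

end Luxemburg

/-! ### Differentiability of the modular -/

section Differentiability

open MeasureTheory Filter Topology

variable {α F : Type*} [MeasurableSpace α] [NormedAddCommGroup F] [InnerProductSpace ℝ F]
  {G g : ℝ → ℝ} {pm pp : ℝ} {ν : Measure α} {f h : α → F}

/-- The derivative of `G ‖·‖` at `a` in direction `z`. -/
noncomputable def gradPair (g : ℝ → ℝ) (a z : F) : ℝ := g ‖a‖ * (inner ℝ a z / ‖a‖)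

theorem gradPair_smul (a z : F) (c : ℝ) : gradPair g a (c • z) = c * gradPair g a z := by
  unfold gradPair
  rw [inner_smul_right]
  ring

theorem gradPair_sub (a z w : F) : gradPair g a (z - w) = gradPair g a z - gradPair g a w := by
  unfold gradPair
  rw [inner_sub_right]
  ring

theorem gradPair_self (a : F) : gradPair g a a = ‖a‖ * g ‖a‖ := by
  unfold gradPair
  rcases eq_or_ne a 0 with rfl | ha
  · simp
  · rw [real_inner_self_eq_norm_sq, sq, mul_div_cancel_right₀ _ (norm_ne_zero_iff.2 ha), mul_comm]

theorem IsYoungFunction.abs_gradPair_le (hG : IsYoungFunction G g) (a z : F) :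
    |gradPair g a z| ≤ g ‖a‖ * ‖z‖ := by
  unfold gradPair
  rw [abs_mul, abs_of_nonneg (hG.deriv_nonneg (norm_nonneg a)), abs_div, abs_norm]
  refine mul_le_mul_of_nonneg_left ?_ (hG.deriv_nonneg (norm_nonneg a))
  exact div_le_of_le_mul₀ (norm_nonneg _) (norm_nonneg _)
    ((abs_real_inner_le_norm a z).trans (mul_comm _ _).le)

theorem GrowthBounds.abs_gradPair_le (hG : IsYoungFunction G g) (hp : GrowthBounds G g pm pp)
    (a z : F) : |gradPair g a z| ≤ pp * (G ‖a‖ + G ‖z‖) :=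
  (hG.abs_gradPair_le a z).trans (hp.deriv_mul_le hG (norm_nonneg _) (norm_nonneg _))

theorem IsYoungFunction.aestronglyMeasurable_gradPair (hG : IsYoungFunction G g)
    (hf : AEStronglyMeasurable f ν) (hh : AEStronglyMeasurable h ν) :
    AEStronglyMeasurable (fun x => gradPair g (f x) (h x)) ν :=
  ((aemeasurable_comp_norm hG.deriv_mono hf).mul
    ((hf.inner hh).aemeasurable.div hf.norm.aemeasurable)).aestronglyMeasurable

theorem GrowthBounds.integrable_gradPair (hG : IsYoungFunction G g)
    (hp : GrowthBounds G g pm pp) (hf : MemOrlicz G ν f) (hh : MemOrlicz G ν h) :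
    Integrable (fun x => gradPair g (f x) (h x)) ν :=
  (((hG.integrable hf).add (hG.integrable hh)).const_mul pp).mono'
    (hG.aestronglyMeasurable_gradPair hf.1 hh.1)
    (ae_of_all _ fun x => hp.abs_gradPair_le hG (f x) (h x))

theorem GrowthBounds.abs_integral_gradPair_le (hG : IsYoungFunction G g)
    (hp : GrowthBounds G g pm pp) (hf : MemOrlicz G ν f) (hh : MemOrlicz G ν h) :
    |∫ x, gradPair g (f x) (h x) ∂ν| ≤ pp * (∫ x, G ‖f x‖ ∂ν + ∫ x, G ‖h x‖ ∂ν) := by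
  rw [← integral_add (hG.integrable hf) (hG.integrable hh), ← integral_const_mul]
  exact norm_integral_le_of_norm_le (f := fun x => gradPair g (f x) (h x))
    (((hG.integrable hf).add (hG.integrable hh)).const_mul pp) (ae_of_all _ fun x => hp.abs_gradPair_le hG (f x) (h x))

/-- The first order Taylor remainder of `z ↦ G ‖z‖` at `a`. -/
noncomputable def taylorRem (G g : ℝ → ℝ) (a z : F) : ℝ := G ‖a + z‖ - G ‖a‖ - gradPair g a z

theorem IsYoungFunction.abs_taylorRem_le (hG : IsYoungFunction G g) (a z : F) :
    |taylorRem G g a z| ≤ 2 * ‖z‖ * g (‖a‖ + ‖z‖) := by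
  have h1 := hG.abs_sub_le (norm_nonneg (a + z)) (norm_nonneg a) (norm_add_le a z)
    (le_add_of_nonneg_right (norm_nonneg z))
  have h2 : |‖a + z‖ - ‖a‖| ≤ ‖z‖ := by
    simpa using abs_norm_sub_norm_le (a + z) a
  have h3 := hG.abs_gradPair_le a z
  have h4 : g ‖a‖ ≤ g (‖a‖ + ‖z‖) := hG.deriv_mono (norm_nonneg _)
    (Set.mem_Ici.2 (by positivity)) (le_add_of_nonneg_right (norm_nonneg z))
  have h5 := hG.deriv_nonneg (t := ‖a‖ + ‖z‖) (by positivity)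
  have h6 := mul_le_mul_of_nonneg_right h2 h5
  have h7 := mul_le_mul_of_nonneg_right h4 (norm_nonneg z)
  have h8 := abs_sub (G ‖a + z‖ - G ‖a‖) (gradPair g a z)
  unfold taylorRem
  linarith

/-- Chain rule: away from the origin the norm is differentiable, as the square root of the squared
norm. -/
theorem IsYoungFunction.taylorRem_isLittleO (hG : IsYoungFunction G g) {a : F} (ha : a ≠ 0)
    {ε : ℝ} (hε : 0 < ε) :
    ∃ δ, 0 < δ ∧ ∀ z : F, ‖z‖ < δ → |taylorRem G g a z| ≤ ε * ‖z‖ := by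
  have hn : 0 < ‖a‖ := norm_pos_iff.2 ha
  have h1 : HasFDerivAt (fun z : F => ‖z‖) ((‖a‖)⁻¹ • innerSL ℝ a) a := by
    have h := ((hasStrictFDerivAt_norm_sq a).hasFDerivAt).sqrt (pow_pos hn 2).ne'
    simp only [Real.sqrt_sq (norm_nonneg _)] at h
    convert h using 1
    ext z
    simp
    field_simp
  have h2 := (hG.hasDerivAt hn).comp_hasFDerivAt a h1
  have h3 := (hasFDerivAt_iff_isLittleO_nhds_zero.1 h2).def hε
  obtain ⟨δ, hδ, h4⟩ := Metric.eventually_nhds_iff.1 h3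
  refine ⟨δ, hδ, fun z hz => ?_⟩
  have h5 := h4 (y := z) (by simpa using hz)
  convert h5 using 1
  simp only [taylorRem, gradPair, Function.comp, Real.norm_eq_abs]
  congr 2
  simp only [smul_eq_mul, smul_apply, innerSL_apply_apply]
  ring

theorem IsYoungFunction.integrable_taylorRem (hG : IsYoungFunction G g)
    (hp : GrowthBounds G g pm pp) (hf : MemOrlicz G ν f) (hh : MemOrlicz G ν h) :
    Integrable (fun x => taylorRem G g (f x) (h x)) ν :=
  ((hG.integrable (hp.memOrlicz_add hG hf hh)).sub (hG.integrable hf)).sub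
    (hp.integrable_gradPair hG hf hh)

theorem IsYoungFunction.integral_taylorRem (hG : IsYoungFunction G g)
    (hp : GrowthBounds G g pm pp) (hf : MemOrlicz G ν f) (hh : MemOrlicz G ν h) :
    ∫ x, taylorRem G g (f x) (h x) ∂ν =
      ∫ x, G ‖f x + h x‖ ∂ν - ∫ x, G ‖f x‖ ∂ν - ∫ x, gradPair g (f x) (h x) ∂ν := by
  have h1 := hG.integrable (hp.memOrlicz_add hG hf hh)
  have h2 := hG.integrable hf
  have h3 := hp.integrable_gradPair hG hf hh
  have h4 : Integrable (fun x => G ‖f x + h x‖ - G ‖f x‖) ν := h1.sub h2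
  unfold taylorRem
  rw [integral_sub h4 h3, integral_sub h1 h2]

/-- Pointwise bounds for the difference quotient of the Taylor remainder, according to which of the
two arguments dominates. -/
theorem GrowthBounds.abs_taylorRem_smul_le (hG : IsYoungFunction G g)
    (hp : GrowthBounds G g pm pp) {c t : ℝ} (hc : 0 < c) (hc1 : c ≤ 1) (ht : 0 < t)
    (htc : t ≤ c / 2) (a z : F) :
    (2 * ‖a‖ ≤ c * ‖z‖ → |taylorRem G g a (t • z)| / t ≤ 2 * pp * c ^ (pm - 1) * G ‖z‖) ∧
    (c * ‖z‖ ≤ 2 * ‖a‖ → |taylorRem G g a (t • z)| / t ≤ 2 / c * pp * G ‖(2 : ℝ) • a‖) := by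
  have hpp : 0 < pp := by linarith [hp.one_lt, hp.lt]
  have h1 := hG.abs_taylorRem_le a (t • z)
  rw [norm_smul, Real.norm_of_nonneg ht.le] at h1
  have h2 : |taylorRem G g a (t • z)| / t ≤ 2 * ‖z‖ * g (‖a‖ + t * ‖z‖) := by
    rw [div_le_iff₀ ht]
    linarith
  -- Consequently `‖a‖ + t * ‖z‖` is at most `c * ‖z‖` in the first case and at most `2 * ‖a‖` in
  -- the second.
  have h3 : t * ‖z‖ ≤ c / 2 * ‖z‖ := mul_le_mul_of_nonneg_right htc (norm_nonneg z)
  have h0 : (0 : ℝ) ≤ ‖a‖ + t * ‖z‖ := by positivity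
  constructor <;> intro hle <;> refine h2.trans ?_
  · have h4 : g (‖a‖ + t * ‖z‖) ≤ g (c * ‖z‖) :=
      hG.deriv_mono h0 (Set.mem_Ici.2 (by positivity)) (by linarith)
    have h5 := hp.upper_mul hG (t := c * ‖z‖) (by positivity)
    have h6 := hp.map_mul_le_of_le_one hG hc hc1 (norm_nonneg z)
    rw [Real.rpow_sub_one hc.ne']
    calc 2 * ‖z‖ * g (‖a‖ + t * ‖z‖) ≤ 2 * ‖z‖ * g (c * ‖z‖) :=
          mul_le_mul_of_nonneg_left h4 (by positivity)
      _ = 2 / c * (c * ‖z‖ * g (c * ‖z‖)) := by field_simp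
      _ ≤ 2 / c * (pp * (c ^ pm * G ‖z‖)) := 
        mul_le_mul_of_nonneg_left (h5.trans (mul_le_mul_of_nonneg_left h6 hpp.le)) (by positivity)
      _ = _ := by ring
  · have e : ‖(2 : ℝ) • a‖ = 2 * ‖a‖ := by rw [norm_smul]; norm_num
    rw [e]
    have h4 : g (‖a‖ + t * ‖z‖) ≤ g (2 * ‖a‖) :=
      hG.deriv_mono h0 (Set.mem_Ici.2 (by positivity)) (by linarith)
    have h5 := hp.upper_mul hG (t := 2 * ‖a‖) (by positivity)
    have h6 := hG.deriv_nonneg (t := 2 * ‖a‖) (by positivity)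
    calc 2 * ‖z‖ * g (‖a‖ + t * ‖z‖) ≤ 2 * ‖z‖ * g (2 * ‖a‖) :=
          mul_le_mul_of_nonneg_left h4 (by positivity)
      _ = 2 / c * (c * ‖z‖ * g (2 * ‖a‖)) := by field_simp
      _ ≤ 2 / c * (pp * G (2 * ‖a‖)) := 
        mul_le_mul_of_nonneg_left ((mul_le_mul_of_nonneg_right hle h6).trans h5) (by positivity)
      _ = _ := by ring

/-- Superlinear growth enters here: the exponent `pm - 1` is positive. -/
theorem GrowthBounds.exists_small_coeff (hp : GrowthBounds G g pm pp) {ε : ℝ} (hε : 0 < ε) :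
    ∃ c : ℝ, 0 < c ∧ c ≤ 1 ∧ 2 * pp * c ^ (pm - 1) ≤ ε := by
  have h1 : Tendsto (fun c : ℝ => 2 * pp * c ^ (pm - 1)) (𝓝[>] 0) (𝓝 0) := by
    have h := ((Real.continuousAt_rpow_const 0 (pm - 1)
      (Or.inr (by linarith [hp.one_lt]))).tendsto.const_mul (2 * pp))
    rw [Real.zero_rpow (by linarith [hp.one_lt]), mul_zero] at h
    exact h.mono_left nhdsWithin_le_nhds
  have h2 : ∀ᶠ c : ℝ in 𝓝[>] 0, c ≤ 1 := nhdsWithin_le_nhds (Iic_mem_nhds one_pos)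
  obtain ⟨c, ⟨h3, h4⟩, h5⟩ :=
    (((eventually_mem_nhdsWithin (a := (0 : ℝ)) (s := Set.Ioi 0)).and h2).and (h1.eventually (Iic_mem_nhds hε))).exists
  exact ⟨c, h3, h4, h5⟩

/-- The modular is Fréchet differentiable. -/
theorem GrowthBounds.integral_taylorRem_isLittleO (hG : IsYoungFunction G g)
    (hp : GrowthBounds G g pm pp) (hf : MemOrlicz G ν f) {ε : ℝ} (hε : 0 < ε) :
    ∃ δ, 0 < δ ∧ ∀ t, 0 < t → t < δ → ∀ k : α → F, AEStronglyMeasurable k ν →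
      modular G ν k ≤ 1 → |∫ x, taylorRem G g (f x) (t • k x) ∂ν| ≤ ε * t := by
  -- Uniformity in `k` is obtained from a sequence of counterexamples `t j → 0`, `k j`, to which
  -- dominated convergence can be applied.
  by_contra! H
  obtain ⟨c, hc, hc1, hcε⟩ := hp.exists_small_coeff (half_pos hε)
  have hpp : 0 < pp := by linarith [hp.one_lt, hp.lt]
  choose t ht htj k hk hk1 hlt using fun j : ℕ => H (1 / ((j : ℝ) + 1)) (by positivity)
  have hkO : ∀ j, MemOrlicz G ν (k j) := fun j => ⟨hk j, (hk1 j).trans_lt ENNReal.one_lt_top⟩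
  have htlim : Tendsto t atTop (𝓝 0) :=
    squeeze_zero (fun j => (ht j).le) (fun j => (htj j).le) tendsto_one_div_add_atTop_nhds_zero_nat
  have hint : ∀ j, Integrable (fun x => |taylorRem G g (f x) (t j • k j x)| / t j) ν := fun j =>
    ((hG.integrable_taylorRem hp hf (hp.memOrlicz_smul hG (hkO j) (t j))).abs).div_const _
  -- The excess of the remainder quotient over `ε / 2 * G ‖k j x‖`. By the choice of `c` it
  -- vanishes, for large `j`, where `k j` dominates `f`, and elsewhere it lies below a fixed
  -- integrable function. The subtracted part integrates to at most `ε / 2`.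
  let r : ℕ → α → ℝ := fun j x =>
    max 0 (|taylorRem G g (f x) (t j • k j x)| / t j - ε / 2 * G ‖k j x‖)
  have hev : ∀ᶠ j in atTop, t j ≤ c / 2 := htlim.eventually (Iic_mem_nhds (half_pos hc))
  have hrzero : ∀ j x, t j ≤ c / 2 → 2 * ‖f x‖ ≤ c * ‖k j x‖ → r j x = 0 := by
    intro j x hj hle
    refine max_eq_left (sub_nonpos.2 (((hp.abs_taylorRem_smul_le hG hc hc1 (ht j) hj _ _).1
      hle).trans ?_))
    exact mul_le_mul_of_nonneg_right hcε (hG.nonneg _ (norm_nonneg _))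
  have hrle : ∀ j x, r j x ≤ |taylorRem G g (f x) (t j • k j x)| / t j := by
    intro j x
    have := mul_nonneg (half_pos hε).le (hG.nonneg _ (norm_nonneg (k j x)))
    exact max_le (div_nonneg (abs_nonneg _) (ht j).le) (by linarith)
  have hlim : Tendsto (fun j => ∫ x, r j x ∂ν) atTop (𝓝 (∫ _, (0 : ℝ) ∂ν)) := by
    refine tendsto_integral_filter_of_dominated_convergence
      (fun x => 2 / c * pp * G ‖(2 : ℝ) • f x‖) ?_ ?_ ?_ ?_
    · refine Eventually.of_forall fun j => ?_
      exact (aestronglyMeasurable_const (b := (0 : ℝ))).sup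
        ((hint j).1.sub ((hG.integrable (hkO j)).1.const_mul _))
    · filter_upwards [hev] with j hj
      refine ae_of_all _ fun x => ?_
      rw [Real.norm_of_nonneg (le_max_left _ _)]
      rcases le_total (2 * ‖f x‖) (c * ‖k j x‖) with hle | hle
      · refine (hrzero j x hj hle).trans_le ?_
        exact mul_nonneg (by positivity) (hG.nonneg _ (norm_nonneg _))
      · exact (hrle j x).trans ((hp.abs_taylorRem_smul_le hG hc hc1 (ht j) hj _ _).2 hle)
    · exact (hG.integrable (hp.memOrlicz_smul hG hf 2)).const_mul _
    · refine ae_of_all _ fun x => ?_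
      -- Where `f x = 0`, the direction `k j x` dominates trivially, so differentiability of `G ‖·‖`
      -- at the origin is not required.
      rcases eq_or_ne (f x) 0 with h0 | h0
      · refine tendsto_const_nhds.congr' ?_
        filter_upwards [hev] with j hj
        refine (hrzero j x hj ?_).symm
        rw [h0, norm_zero, mul_zero]
        positivity
      · have hn : 0 < ‖f x‖ := norm_pos_iff.2 h0
        rw [Metric.tendsto_nhds]
        intro η hη
        -- In the remaining case `‖k j x‖ ≤ 2 * ‖f x‖ / c`, so this constant bounds the quotient by
        -- `η / 2`.
        obtain ⟨δ, hδ, hδ'⟩ := hG.taylorRem_isLittleO h0 (ε := η * c / (4 * ‖f x‖)) (by positivity)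
        have hev2 : ∀ᶠ j in atTop, t j < δ * c / (2 * ‖f x‖) :=
          htlim.eventually (Iio_mem_nhds (by positivity))
        filter_upwards [hev, hev2] with j hj hj2
        rw [Real.dist_eq, sub_zero, abs_of_nonneg (le_max_left _ _)]
        rcases le_total (2 * ‖f x‖) (c * ‖k j x‖) with hle | hle
        · exact (hrzero j x hj hle).trans_lt hη
        · refine (hrle j x).trans_lt ?_
          have hz : ‖t j • k j x‖ = t j * ‖k j x‖ := by
            rw [norm_smul, Real.norm_of_nonneg (ht j).le]
          rw [lt_div_iff₀ (by positivity)] at hj2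
          have h1 : t j * ‖k j x‖ < δ := by
            have := mul_le_mul_of_nonneg_left hle (ht j).le
            nlinarith
          have h2 := hδ' (t j • k j x) (hz ▸ h1)
          rw [hz] at h2
          rw [div_lt_iff₀ (ht j)]
          refine h2.trans_lt ?_
          have h3 : η * c / (4 * ‖f x‖) * (t j * ‖k j x‖) =
              η * t j * ((c * ‖k j x‖) / (4 * ‖f x‖)) := by ring
          rw [h3]
          refine mul_lt_of_lt_one_right (mul_pos hη (ht j)) ?_
          rw [div_lt_one (by positivity)]
          linarith
  rw [integral_zero] at hlim
  obtain ⟨j, hj⟩ := (hlim.eventually (Iio_mem_nhds (half_pos hε))).exists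
  have hj : ∫ x, r j x ∂ν < ε / 2 := hj
  have hGk := hG.integrable (hkO j)
  have hrint : Integrable (r j) ν :=
    (integrable_zero α ℝ ν).sup ((hint j).sub (hGk.const_mul _))
  have h1 : ∫ x, |taylorRem G g (f x) (t j • k j x)| / t j ∂ν ≤
      ∫ x, (r j x + ε / 2 * G ‖k j x‖) ∂ν :=
    integral_mono (hint j) (hrint.add (hGk.const_mul _)) fun x => by
      have := le_max_right 0 (|taylorRem G g (f x) (t j • k j x)| / t j - ε / 2 * G ‖k j x‖)
      simp only [r]
      linarith
  rw [integral_add hrint (hGk.const_mul _), integral_const_mul, integral_div] at h1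
  have h2 := hG.integral_le_one (hkO j) (hk1 j)
  have h3 : ε / 2 * ∫ x, G ‖k j x‖ ∂ν ≤ ε / 2 := mul_le_of_le_one_right (half_pos hε).le h2
  have h4 : (∫ x, |taylorRem G g (f x) (t j • k j x)| ∂ν) / t j < ε := by linarith
  rw [div_lt_iff₀ (ht j)] at h4
  have h5 : |∫ x, taylorRem G g (f x) (t j • k j x) ∂ν| ≤
      ∫ x, |taylorRem G g (f x) (t j • k j x)| ∂ν := abs_integral_le_integral_abs
  linarith [hlt j]

end Differentiability

/-! ### Differentiability of the Luxemburg norm -/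

section LuxemburgDifferentiability

open MeasureTheory Filter Topology

variable {α F : Type*} [MeasurableSpace α] [NormedAddCommGroup F] [InnerProductSpace ℝ F]
  {G g : ℝ → ℝ} {pm pp : ℝ} {ν : Measure α} {f h : α → F}

/-- Expansion of the modular of `(1 + c t)⁻¹ (f + t k)` to first order in `t`, uniformly in `k` and
in bounded `c`, for `f` of modular one. -/
theorem GrowthBounds.modular_expansion (hG : IsYoungFunction G g)
    (hp : GrowthBounds G g pm pp) (hf : MemOrlicz G ν f) (hf1 : modular G ν f = 1)
    (C : ℝ) {η : ℝ} (hη : 0 < η) :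
    ∃ δ, 0 < δ ∧ ∀ t, 0 < t → t < δ → ∀ k : α → F, AEStronglyMeasurable k ν →
      modular G ν k ≤ 1 → ∀ c, |c| ≤ C → 1 / 2 ≤ 1 + c * t ∧ 1 + c * t ≤ 3 / 2 ∧
        |∫ x, G ‖(1 + c * t)⁻¹ • (f x + t • k x)‖ ∂ν - 1 -
          t * (∫ x, gradPair g (f x) (k x) ∂ν - c * ∫ x, gradPair g (f x) (f x) ∂ν) /
            (1 + c * t)| ≤ η * t := by
  set D := max 1 C with hD
  have hD1 : 1 ≤ D := le_max_left _ _
  obtain ⟨δ, hδ, H⟩ := hp.integral_taylorRem_isLittleO hG hf (ε := η / (8 * D)) (by positivity)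
  refine ⟨min (1 / (2 * D)) (δ / (8 * D)), by positivity, ?_⟩
  intro t ht htδ k hk hk1 c hc
  have htD : t * D < 1 / 2 := by
    have := htδ.trans_le (min_le_left _ _)
    rw [lt_div_iff₀ (by positivity)] at this
    linarith
  have htδ' : t * (8 * D) < δ := by
    have := htδ.trans_le (min_le_right _ _)
    rwa [lt_div_iff₀ (by positivity)] at this
  have hcD : |c| ≤ D := hc.trans (le_max_right _ _)
  have hct : |c * t| ≤ 1 / 2 := by
    rw [abs_mul, abs_of_pos ht]
    nlinarith
  obtain ⟨hct1, hct2⟩ := abs_le.1 hct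
  have hτ : 0 < 1 + c * t := by linarith
  set τ := 1 + c * t with hτdef
  refine ⟨by linarith, by linarith, ?_⟩
  have hkO : MemOrlicz G ν k := ⟨hk, hk1.trans_lt ENNReal.one_lt_top⟩
  -- Chosen so that `τ⁻¹ • (f + t • k) = f + (t * (8 * D)) • b • (k - c • f)`, where `b ≤ 1 / (4 *
  -- D)` keeps the modular of the new direction at most one by `map_quarter_add_le`.
  set b := τ⁻¹ * (8 * D)⁻¹ with hb
  have hb0 : 0 ≤ b := by positivity
  have hτinv : τ⁻¹ ≤ 2 := by
    rw [inv_le_comm₀ hτ two_pos]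
    linarith
  have hbD : b ≤ 4⁻¹ * D⁻¹ := by
    calc b ≤ 2 * (8 * D)⁻¹ := mul_le_mul_of_nonneg_right hτinv (by positivity)
      _ = 4⁻¹ * D⁻¹ := by rw [mul_inv]; ring
  have hDinv : D⁻¹ ≤ 1 := inv_le_one_of_one_le₀ hD1
  have hk'm : AEStronglyMeasurable (fun x => b • (k x - c • f x)) ν :=
    (hk.sub (hf.1.const_smul c)).const_smul b
  have hk'le : modular G ν (fun x => b • (k x - c • f x)) ≤ 1 := by
    calc modular G ν (fun x => b • (k x - c • f x))
        ≤ ∫⁻ x, ENNReal.ofReal 2⁻¹ * (ENNReal.ofReal (G ‖k x‖) + ENNReal.ofReal (G ‖f x‖)) ∂ν := by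
          refine lintegral_mono fun x => ?_
          rw [← ENNReal.ofReal_add (hG.nonneg _ (norm_nonneg _)) (hG.nonneg _ (norm_nonneg _)),
            ← ENNReal.ofReal_mul (by positivity)]
          refine ENNReal.ofReal_le_ofReal ((hG.mono (norm_nonneg _)
            (Set.mem_Ici.2 (by positivity)) ?_).trans
              (hp.map_quarter_add_le hG (norm_nonneg (k x)) (norm_nonneg (f x))))
          rw [norm_smul, Real.norm_of_nonneg hb0]
          have h1 : ‖k x - c • f x‖ ≤ ‖k x‖ + D * ‖f x‖ := by
            refine (norm_sub_le _ _).trans ?_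
            rw [norm_smul, Real.norm_eq_abs]
            gcongr
          calc b * ‖k x - c • f x‖ ≤ 4⁻¹ * D⁻¹ * (‖k x‖ + D * ‖f x‖) := by gcongr
            _ = 4⁻¹ * (D⁻¹ * ‖k x‖ + ‖f x‖) := by field_simp
            _ ≤ 4⁻¹ * (‖k x‖ + ‖f x‖) := by
              gcongr
              exact mul_le_of_le_one_left (norm_nonneg _) hDinv
      _ = ENNReal.ofReal 2⁻¹ * (modular G ν k + modular G ν f) := by
          rw [lintegral_const_mul' _ _ ENNReal.ofReal_ne_top, lintegral_add_left']
          · rfl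
          · exact (aemeasurable_comp_norm hG.mono hk).ennreal_ofReal
      _ ≤ ENNReal.ofReal 2⁻¹ * (1 + 1) := by
          rw [hf1]
          gcongr
      _ = 1 := by
          rw [one_add_one_eq_two, ENNReal.ofReal_inv_of_pos two_pos, ENNReal.ofReal_ofNat]
          exact ENNReal.inv_mul_cancel two_ne_zero ENNReal.ofNat_ne_top
  have hk'O : MemOrlicz G ν (fun x => b • (k x - c • f x)) :=
    ⟨hk'm, hk'le.trans_lt ENNReal.one_lt_top⟩
  have key := H (t * (8 * D)) (by positivity) htδ' _ hk'm hk'le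
  rw [hG.integral_taylorRem hp hf (hp.memOrlicz_smul hG hk'O _)] at key
  have e1 : ∫ x, G ‖f x‖ ∂ν = 1 := by
    have := hG.ofReal_integral hf
    rw [hf1, ENNReal.ofReal_eq_one] at this
    exact this
  have e2 : ∀ x, f x + (t * (8 * D)) • b • (k x - c • f x) = τ⁻¹ • (f x + t • k x) := by
    intro x
    have e3 : (t * (8 * D)) * b = τ⁻¹ * t := by
      rw [hb]
      field_simp
    rw [smul_smul, e3]
    have e4 : τ⁻¹ • (f x + (c * t) • f x) = f x := by
      rw [inv_smul_eq_iff₀ hτ.ne', hτdef]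
      module
    calc f x + (τ⁻¹ * t) • (k x - c • f x)
        = τ⁻¹ • (f x + (c * t) • f x) + (τ⁻¹ * t) • (k x - c • f x) := by rw [e4]
      _ = τ⁻¹ • (f x + t • k x) := by module
  have e5 : ∫ x, gradPair g (f x) ((t * (8 * D)) • b • (k x - c • f x)) ∂ν =
      t * (∫ x, gradPair g (f x) (k x) ∂ν - c * ∫ x, gradPair g (f x) (f x) ∂ν) / τ := by
    simp only [gradPair_smul, gradPair_sub]
    rw [integral_const_mul, integral_const_mul, integral_sub (hp.integrable_gradPair hG hf hkO)
      ((hp.integrable_gradPair hG hf hf).const_mul c), integral_const_mul, hb]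
    field_simp
  simp only [e2, e5, e1] at key
  refine key.trans (le_of_eq ?_)
  field_simp

theorem GrowthBounds.le_integral_gradPair_self (hG : IsYoungFunction G g)
    (hp : GrowthBounds G g pm pp) (hf : MemOrlicz G ν f) :
    pm * ∫ x, G ‖f x‖ ∂ν ≤ ∫ x, gradPair g (f x) (f x) ∂ν := by
  rw [← integral_const_mul]
  refine integral_mono ((hG.integrable hf).const_mul _) (hp.integrable_gradPair hG hf hf)
    fun x => ?_
  simp only [gradPair_self]
  exact hp.lower_mul hG (norm_nonneg _)

theorem GrowthBounds.integral_gradPair_self_pos (hG : IsYoungFunction G g)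
    (hp : GrowthBounds G g pm pp) (hf : MemOrlicz G ν f) (hf1 : modular G ν f = 1) :
    0 < ∫ x, gradPair g (f x) (f x) ∂ν := by
  have := hG.ofReal_integral hf
  rw [hf1, ENNReal.ofReal_eq_one] at this
  have h := hp.le_integral_gradPair_self hG hf
  rw [this] at h
  linarith [hp.one_lt]

/-- An implicit function argument by hand. With `l` the derivative of the modular along `k` and `a`
the one along `f`, dividing by `1 + (l / a ∓ ε) * t` gives modular `1 ± a ε t / τ` up to an error `a
ε t / 2`. As `τ ≤ 3 / 2`, the main term is at least `2 / 3 * a ε t` and decides on which side of one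
the modular lies. -/
theorem GrowthBounds.luxemburg_expansion_of_modular_eq_one (hG : IsYoungFunction G g)
    (hp : GrowthBounds G g pm pp) (hf : MemOrlicz G ν f) (hf1 : modular G ν f = 1)
    {ε : ℝ} (hε : 0 < ε) :
    ∃ δ, 0 < δ ∧ ∀ t, 0 < t → t < δ → ∀ k : α → F, AEStronglyMeasurable k ν →
      modular G ν k ≤ 1 → |luxemburg G ν (fun x => f x + t • k x) - 1 -
        t * ((∫ x, gradPair g (f x) (k x) ∂ν) / ∫ x, gradPair g (f x) (f x) ∂ν)| ≤ ε * t := by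
  set a := ∫ x, gradPair g (f x) (f x) ∂ν with ha
  have ha0 : 0 < a := hp.integral_gradPair_self_pos hG hf hf1
  have hpp : 0 < pp := by linarith [hp.one_lt, hp.lt]
  -- The first constant bounds `|l / a ± ε|` uniformly in `k`, because `f` and `k` both have modular
  -- at most one.
  obtain ⟨δ, hδ, H⟩ := hp.modular_expansion hG hf hf1 (pp * 2 / a + ε) (η := a * ε / 2)
    (by positivity)
  refine ⟨δ, hδ, fun t ht htδ k hk hk1 => ?_⟩
  have hkO : MemOrlicz G ν k := ⟨hk, hk1.trans_lt ENNReal.one_lt_top⟩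
  have hsumO : MemOrlicz G ν (fun x => f x + t • k x) :=
    hp.memOrlicz_add hG hf (hp.memOrlicz_smul hG hkO t)
  set l := ∫ x, gradPair g (f x) (k x) ∂ν with hl
  have hlle : |l / a| ≤ pp * 2 / a := by
    rw [abs_div, abs_of_pos ha0]
    gcongr
    refine (hp.abs_integral_gradPair_le hG hf hkO).trans ?_
    gcongr
    linarith [hG.integral_le_one hf hf1.le, hG.integral_le_one hkO hk1]
  have hal : l / a * a = l := div_mul_cancel₀ _ ha0.ne'
  have hmod : ∀ τ : ℝ, ENNReal.ofReal (∫ x, G ‖τ⁻¹ • (f x + t • k x)‖ ∂ν) =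
      modular G ν (fun x => τ⁻¹ • (f x + t • k x)) := fun τ =>
    hG.ofReal_integral (hp.memOrlicz_smul hG hsumO τ⁻¹)
  have haet : 0 < a * ε * t := by positivity
  rw [abs_le]
  constructor
  · obtain ⟨h1, h2, h3⟩ := H t ht htδ k hk hk1 (l / a - ε)
      ((abs_sub _ _).trans (by rw [abs_of_pos hε]; gcongr))
    set τ := 1 + (l / a - ε) * t with hτ
    have e : t * (l - (l / a - ε) * a) / τ = a * ε * t / τ := by
      rw [sub_mul, hal]; ring
    rw [e] at h3
    have h4 : a * ε * t * (2 / 3) ≤ a * ε * t / τ := by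
      rw [div_eq_mul_inv]
      refine mul_le_mul_of_nonneg_left ?_ haet.le
      rw [le_inv_comm₀ (by norm_num) (by linarith)]
      norm_num
      linarith
    have h5 : τ ≤ luxemburg G ν (fun x => f x + t • k x) := by
      refine hp.le_luxemburg hG hsumO.2 ?_
      rw [← hmod, ← ENNReal.ofReal_one, ENNReal.ofReal_lt_ofReal_iff_of_nonneg zero_le_one]
      linarith [(abs_le.1 h3).1]
    linarith
  · obtain ⟨h1, h2, h3⟩ := H t ht htδ k hk hk1 (l / a + ε)
      ((abs_add_le _ _).trans (by rw [abs_of_pos hε]; gcongr))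
    set τ := 1 + (l / a + ε) * t with hτ
    have e : t * (l - (l / a + ε) * a) / τ = -(a * ε * t / τ) := by
      rw [add_mul, hal]; ring
    rw [e] at h3
    have h4 : a * ε * t * (2 / 3) ≤ a * ε * t / τ := by
      rw [div_eq_mul_inv]
      refine mul_le_mul_of_nonneg_left ?_ haet.le
      rw [le_inv_comm₀ (by norm_num) (by linarith)]
      norm_num
      linarith
    have h5 : luxemburg G ν (fun x => f x + t • k x) ≤ τ := by
      refine luxemburg_le (by linarith) ?_
      rw [← hmod, ENNReal.ofReal_le_one]
      linarith [(abs_le.1 h3).2]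
    linarith

/-- The derivative of the Luxemburg norm at `f` in direction `h`. -/
noncomputable def luxemburgDeriv (G g : ℝ → ℝ) (ν : Measure α) (f h : α → F) : ℝ :=
  (∫ x, gradPair g ((luxemburg G ν f)⁻¹ • f x) (h x) ∂ν) /
    ∫ x, gradPair g ((luxemburg G ν f)⁻¹ • f x) ((luxemburg G ν f)⁻¹ • f x) ∂ν

theorem luxemburgDeriv_smul (c : ℝ) :
    luxemburgDeriv G g ν f (fun x => c • h x) = c * luxemburgDeriv G g ν f h := by
  unfold luxemburgDeriv
  simp only [gradPair_smul]
  rw [integral_const_mul, mul_div_assoc]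

/-- The Luxemburg norm is Fréchet differentiable away from zero. -/
theorem GrowthBounds.luxemburg_frechet (hG : IsYoungFunction G g)
    (hp : GrowthBounds G g pm pp) (hf : MemOrlicz G ν f) (hf0 : ¬ f =ᵐ[ν] 0)
    {ε : ℝ} (hε : 0 < ε) :
    ∃ δ, 0 < δ ∧ ∀ h : α → F, MemOrlicz G ν h → ∀ w, luxemburg G ν h ≤ w → w < δ →
      |luxemburg G ν (fun x => f x + h x) - luxemburg G ν f - luxemburgDeriv G g ν f h| ≤
        ε * w := by
  have hN := hp.luxemburg_pos hG hf hf0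
  have hmod := hp.modular_luxemburg hG hf hf0
  set N := luxemburg G ν f with hNdef
  obtain ⟨δ, hδ, H⟩ := hp.luxemburg_expansion_of_modular_eq_one hG
    (hp.memOrlicz_smul hG hf N⁻¹) hmod hε
  refine ⟨N * δ, by positivity, fun h hh w hw hwδ => ?_⟩
  have hw0 : 0 ≤ w := luxemburg_nonneg.trans hw
  -- A strict `t > w` guarantees that `t⁻¹ • h` has modular at most one, even when `w = 0`; the
  -- estimate at `w` follows by letting `t` decrease to `w`.
  have key : ∀ t, w < t → t < N * δ →
      |luxemburg G ν (fun x => f x + h x) - N - luxemburgDeriv G g ν f h| ≤ ε * t := by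
    intro t hwt htδ
    have ht : 0 < t := hw0.trans_lt hwt
    have h1 := H (t / N) (by positivity) (by rwa [div_lt_iff₀ hN, mul_comm])
      (fun x => t⁻¹ • h x) (hh.1.const_smul _)
      (hp.modular_le_one_of_luxemburg_lt hG hh.2 (hw.trans_lt hwt))
    have e1 : (fun x => N⁻¹ • f x + (t / N) • t⁻¹ • h x) = fun x => N⁻¹ • (f x + h x) := by
      ext x
      rw [smul_smul, smul_add]
      congr 2
      field_simp
    rw [e1, luxemburg_smul (inv_ne_zero hN.ne'), abs_of_pos (inv_pos.2 hN)] at h1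
    simp only [gradPair_smul] at h1
    rw [integral_const_mul] at h1
    have e2 : luxemburg G ν (fun x => f x + h x) - N - luxemburgDeriv G g ν f h =
        N * (N⁻¹ * luxemburg G ν (fun x => f x + h x) - 1 - t / N *
          (t⁻¹ * (∫ x, gradPair g (N⁻¹ • f x) (h x) ∂ν) /
            (N⁻¹ * ∫ x, gradPair g (N⁻¹ • f x) (f x) ∂ν))) := by
      unfold luxemburgDeriv
      simp only [gradPair_smul]
      rw [integral_const_mul, ← hNdef]
      field_simp
    rw [integral_const_mul] at h1
    rw [e2, abs_mul, abs_of_pos hN]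
    calc _ ≤ N * (ε * (t / N)) := by gcongr
      _ = ε * t := by field_simp
  have hlim : Tendsto (fun t => ε * t) (𝓝[>] w) (𝓝 (ε * w)) :=
    (tendsto_id.const_mul ε).mono_left nhdsWithin_le_nhds
  refine ge_of_tendsto hlim ?_
  filter_upwards [Ioo_mem_nhdsGT hwδ] with t ht
  exact key t ht.1 ht.2

/-- By homogeneity `h` may be divided by any `t > w`; then both functions have modular at most one
and `abs_integral_gradPair_le` bounds the numerator by `pp * 2`. -/
theorem GrowthBounds.abs_luxemburgDeriv_le (hG : IsYoungFunction G g)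
    (hp : GrowthBounds G g pm pp) (hf : MemOrlicz G ν f) (hf0 : ¬ f =ᵐ[ν] 0) :
    ∃ C, 0 ≤ C ∧ ∀ h : α → F, MemOrlicz G ν h → ∀ w, luxemburg G ν h ≤ w →
      |luxemburgDeriv G g ν f h| ≤ C * w := by
  have hmod := hp.modular_luxemburg hG hf hf0
  have hfO := hp.memOrlicz_smul hG hf (luxemburg G ν f)⁻¹
  have ha := hp.integral_gradPair_self_pos hG hfO hmod
  have hpp : 0 < pp := by linarith [hp.one_lt, hp.lt]
  refine ⟨pp * 2 / ∫ x, gradPair g ((luxemburg G ν f)⁻¹ • f x) ((luxemburg G ν f)⁻¹ • f x) ∂ν,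
    by positivity, fun h hh w hw => ?_⟩
  have key : ∀ t, w < t → |luxemburgDeriv G g ν f h| ≤ pp * 2 /
      (∫ x, gradPair g ((luxemburg G ν f)⁻¹ • f x) ((luxemburg G ν f)⁻¹ • f x) ∂ν) * t := by
    intro t hwt
    have ht : 0 < t := (luxemburg_nonneg.trans hw).trans_lt hwt
    have hhO := hp.memOrlicz_smul hG hh t⁻¹
    have e : luxemburgDeriv G g ν f h = t * luxemburgDeriv G g ν f (fun x => t⁻¹ • h x) := by
      rw [luxemburgDeriv_smul, mul_inv_cancel_left₀ ht.ne']
    rw [e, abs_mul, abs_of_pos ht, mul_comm]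
    refine mul_le_mul_of_nonneg_right ?_ ht.le
    unfold luxemburgDeriv
    rw [abs_div, abs_of_pos ha]
    gcongr
    refine (hp.abs_integral_gradPair_le hG hfO hhO).trans ?_
    gcongr
    linarith [hG.integral_le_one hfO hmod.le, hG.integral_le_one hhO
      (hp.modular_le_one_of_luxemburg_lt hG hh.2 (hw.trans_lt hwt))]
  refine ge_of_tendsto ((tendsto_id.const_mul _).mono_left nhdsWithin_le_nhds : Tendsto _ (𝓝[>] w) _)
    ?_
  filter_upwards [self_mem_nhdsWithin] with t ht
  exact key t ht

end LuxemburgDifferentiability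

/-! ### Weak gradients and the Poincaré inequality -/

section WeakGradient

open MeasureTheory Filter Topology

variable {n : ℕ} {Ω : Set (EuclideanSpace ℝ (Fin n))} {u v : EuclideanSpace ℝ (Fin n) → ℝ}
  {F F' : EuclideanSpace ℝ (Fin n) → EuclideanSpace ℝ (Fin n)}

theorem integrable_smul_of_locallyIntegrableOn {E' : Type*} [NormedAddCommGroup E']
    [NormedSpace ℝ E'] {η : EuclideanSpace ℝ (Fin n) → ℝ} {f : EuclideanSpace ℝ (Fin n) → E'}
    (hη : Continuous η) (hηc : HasCompactSupport η) (hηΩ : tsupport η ⊆ Ω)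
    (hf : LocallyIntegrableOn f Ω) : Integrable (fun x => η x • f x) := by
  have h1 : IntegrableOn f (tsupport η) := hf.integrableOn_compact_subset hηΩ hηc
  refine (integrableOn_iff_integrable_of_support_subset ?_).1
    (h1.continuousOn_smul hη.continuousOn hηc)
  exact (Function.support_smul_subset_left _ _).trans (subset_tsupport η)

theorem IsTestFunction.continuous_fderiv {φ : EuclideanSpace ℝ (Fin n) → ℝ}
    (hφ : IsTestFunction Ω φ) : Continuous (fderiv ℝ φ) :=
  hφ.smooth.continuous_fderiv (by simp)

theorem IsTestFunction.integrable_fderiv {φ : EuclideanSpace ℝ (Fin n) → ℝ}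
    (hφ : IsTestFunction Ω φ) (w : EuclideanSpace ℝ (Fin n)) (hu : LocallyIntegrableOn u Ω) :
    Integrable (fun x => u x * fderiv ℝ φ x w) := by
  have h := integrable_smul_of_locallyIntegrableOn (η := fun x => fderiv ℝ φ x w)
    (hφ.continuous_fderiv.clm_apply continuous_const) (hφ.compact_supp.fderiv_apply ℝ w)
    ((tsupport_fderiv_apply_subset ℝ w).trans hφ.supp_subset) hu
  simpa only [smul_eq_mul, mul_comm] using h

theorem IsTestFunction.integrable_inner {φ : EuclideanSpace ℝ (Fin n) → ℝ}
    (hφ : IsTestFunction Ω φ) (w : EuclideanSpace ℝ (Fin n)) (hF : LocallyIntegrableOn F Ω) :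
    Integrable (fun x => inner ℝ (F x) w * φ x) := by
  have h := (integrable_smul_of_locallyIntegrableOn hφ.smooth.continuous hφ.compact_supp
    hφ.supp_subset hF).inner_const (𝕜 := ℝ) w
  simpa only [real_inner_smul_left, mul_comm] using h

/-- The fundamental lemma of the calculus of variations, with vector values tested against every
direction `w`. It makes the choice in `weakGrad` harmless, so that `weakGrad` is linear up to null
sets. -/
theorem IsWeakGradient.ae_eq (hΩ : IsOpen Ω) (h : IsWeakGradient Ω u F)
    (h' : IsWeakGradient Ω u F') : F =ᵐ[volume.restrict Ω] F' := by
  have key := hΩ.ae_eq_zero_of_integral_contDiff_smul_eq_zero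
    (h.locInt_grad.sub h'.locInt_grad) fun φ hφ hφc hφΩ => by
      have ht : IsTestFunction Ω φ := ⟨hφ, hφc, hφΩ⟩
      refine ext_inner_right ℝ fun w => ?_
      have hint := integrable_smul_of_locallyIntegrableOn hφ.continuous hφc hφΩ
        (h.locInt_grad.sub h'.locInt_grad)
      rw [inner_zero_left, real_inner_comm, ← integral_inner hint]
      have e1 : ∀ x, inner ℝ w (φ x • (F - F') x) =
          inner ℝ (F x) w * φ x - inner ℝ (F' x) w * φ x := by
        intro x
        rw [real_inner_smul_right, Pi.sub_apply, inner_sub_right,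
          real_inner_comm (F x), real_inner_comm (F' x)]
        ring
      simp only [e1]
      have e2 : ∀ F₀ : EuclideanSpace ℝ (Fin n) → EuclideanSpace ℝ (Fin n),
          ∫ x in Ω, inner ℝ (F₀ x) w * φ x = ∫ x, inner ℝ (F₀ x) w * φ x := fun F₀ =>
        setIntegral_eq_integral_of_forall_compl_eq_zero fun x hx => by
          rw [image_eq_zero_of_notMem_tsupport fun hx' => hx (hφΩ hx'), mul_zero]
      rw [integral_sub (ht.integrable_inner w h.locInt_grad)
        (ht.integrable_inner w h'.locInt_grad), ← e2, ← e2, sub_eq_zero, ← neg_inj,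
        ← h.integral_eq φ ht w, ← h'.integral_eq φ ht w]
  rw [EventuallyEq, ae_restrict_iff' hΩ.measurableSet]
  filter_upwards [key] with x hx hxΩ
  exact sub_eq_zero.1 (hx hxΩ)

theorem IsWeakGradient.add (h : IsWeakGradient Ω u F) (h' : IsWeakGradient Ω v F') :
    IsWeakGradient Ω (u + v) (F + F') where
  locInt := h.locInt.add h'.locInt
  locInt_grad := h.locInt_grad.add h'.locInt_grad
  integral_eq φ hφ w := by
    simp only [Pi.add_apply, inner_add_left, add_mul]
    rw [integral_add (hφ.integrable_fderiv w h.locInt).integrableOn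
      (hφ.integrable_fderiv w h'.locInt).integrableOn,
      integral_add (hφ.integrable_inner w h.locInt_grad).integrableOn
      (hφ.integrable_inner w h'.locInt_grad).integrableOn, h.integral_eq φ hφ w,
      h'.integral_eq φ hφ w]
    ring

theorem IsWeakGradient.smul (h : IsWeakGradient Ω u F) (c : ℝ) :
    IsWeakGradient Ω (c • u) (c • F) where
  locInt := h.locInt.smul c
  locInt_grad := h.locInt_grad.smul c
  integral_eq φ hφ w := by
    simp only [Pi.smul_apply, real_inner_smul_left, smul_eq_mul, mul_assoc]
    rw [integral_const_mul, integral_const_mul, h.integral_eq φ hφ w]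
    ring

theorem IsWeakGradient.weakGrad (h : IsWeakGradient Ω u F) :
    IsWeakGradient Ω u (weakGrad Ω u) := by
  have hex : ∃ F, IsWeakGradient Ω u F := ⟨F, h⟩
  rw [FracOrlicz.weakGrad, dif_pos hex]
  exact hex.choose_spec

theorem IsWeakGradient.weakGrad_ae_eq (hΩ : IsOpen Ω) (h : IsWeakGradient Ω u F) :
    FracOrlicz.weakGrad Ω u =ᵐ[volume.restrict Ω] F :=
  h.weakGrad.ae_eq hΩ h

theorem continuous_gradient_of_fderiv {φ : EuclideanSpace ℝ (Fin n) → ℝ}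
    (h : Continuous (fderiv ℝ φ)) : Continuous (gradient φ) :=
  (InnerProductSpace.toDual ℝ _).symm.continuous.comp h

theorem norm_gradient (φ : EuclideanSpace ℝ (Fin n) → ℝ) (x : EuclideanSpace ℝ (Fin n)) :
    ‖gradient φ x‖ = ‖fderiv ℝ φ x‖ :=
  (InnerProductSpace.toDual ℝ _).symm.norm_map _

theorem IsTestFunction.isWeakGradient_gradient {φ : EuclideanSpace ℝ (Fin n) → ℝ}
    (hφ : IsTestFunction Ω φ) : IsWeakGradient Ω φ (gradient φ) where
  locInt := hφ.smooth.continuous.locallyIntegrable.locallyIntegrableOn Ω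
  locInt_grad := (continuous_gradient_of_fderiv
    hφ.continuous_fderiv).locallyIntegrable.locallyIntegrableOn Ω
  integral_eq ψ hψ w := by
    have hl : LocallyIntegrableOn φ Ω :=
      hφ.smooth.continuous.locallyIntegrable.locallyIntegrableOn Ω
    have hl' : LocallyIntegrableOn ψ Ω :=
      hψ.smooth.continuous.locallyIntegrable.locallyIntegrableOn Ω
    have hd : ∀ {χ : EuclideanSpace ℝ (Fin n) → ℝ}, IsTestFunction Ω χ → Differentiable ℝ χ :=
      fun hχ => hχ.smooth.differentiable (by simp)
    have hz : ∀ x, x ∉ Ω → ψ x = 0 := fun x hx =>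
      image_eq_zero_of_notMem_tsupport fun hx' => hx (hψ.supp_subset hx')
    have hz' : ∀ x, x ∉ Ω → φ x = 0 := fun x hx =>
      image_eq_zero_of_notMem_tsupport fun hx' => hx (hφ.supp_subset hx')
    simp only [inner_gradient_left]
    rw [setIntegral_eq_integral_of_forall_compl_eq_zero fun x hx => by rw [hz' x hx, zero_mul],
      setIntegral_eq_integral_of_forall_compl_eq_zero fun x hx => by rw [hz x hx, mul_zero]]
    refine integral_mul_fderiv_eq_neg_fderiv_mul_of_integrable ?_ (hψ.integrable_fderiv w hl) ?_
      (fun x _ => hd hφ x) (fun x _ => hd hψ x)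
    · simpa only [mul_comm] using hφ.integrable_fderiv w hl'
    · simpa only [smul_eq_mul] using integrable_smul_of_locallyIntegrableOn hφ.smooth.continuous
        hφ.compact_supp hφ.supp_subset hl'

/-- Fundamental theorem of calculus along the segment from `x` to `x + h`, then Tonelli and
translation invariance. -/
theorem lintegral_enorm_translate_sub_le {E : Type*} [NormedAddCommGroup E] [NormedSpace ℝ E]
    [FiniteDimensional ℝ E] [MeasurableSpace E] [BorelSpace E] (μ : Measure E)
    [μ.IsAddHaarMeasure] {φ : E → ℝ} (hφ : ContDiff ℝ 1 φ) (h : E) :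
    ∫⁻ x, ‖φ (x + h) - φ x‖ₑ ∂μ ≤ (∫⁻ x, ‖fderiv ℝ φ x‖ₑ ∂μ) * ‖h‖ₑ := by
  have hc : Continuous (fderiv ℝ φ) := hφ.continuous_fderiv one_ne_zero
  have hpt : ∀ x, ‖φ (x + h) - φ x‖ₑ ≤
      ∫⁻ t : ℝ in Set.Ioc 0 1, ‖fderiv ℝ φ (x + t • h)‖ₑ * ‖h‖ₑ := by
    intro x
    have hd : ∀ t : ℝ, HasDerivAt (fun t : ℝ => φ (x + t • h)) (fderiv ℝ φ (x + t • h) h) t := by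
      intro t
      have h1 : HasDerivAt (fun t : ℝ => x + t • h) h t := by
        simpa using ((hasDerivAt_id t).smul_const h).const_add x
      exact ((hφ.differentiable one_ne_zero) (x + t • h)).hasFDerivAt.comp_hasDerivAt t h1
    have hcont : Continuous fun t : ℝ => fderiv ℝ φ (x + t • h) h :=
      (hc.comp (by fun_prop)).clm_apply continuous_const
    have h2 := intervalIntegral.integral_eq_sub_of_hasDerivAt (a := 0) (b := 1)
      (fun t _ => hd t) (hcont.intervalIntegrable _ _)
    rw [intervalIntegral.integral_of_le zero_le_one, one_smul, zero_smul, add_zero] at h2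
    rw [← h2]
    refine (enorm_integral_le_lintegral_enorm _).trans (lintegral_mono fun t => ?_)
    exact ContinuousLinearMap.le_opENorm _ _
  calc ∫⁻ x, ‖φ (x + h) - φ x‖ₑ ∂μ
      ≤ ∫⁻ x : E, (∫⁻ t in Set.Ioc (0 : ℝ) 1, ‖fderiv ℝ φ (x + t • h)‖ₑ * ‖h‖ₑ) ∂μ := lintegral_mono hpt
    _ = ∫⁻ t in Set.Ioc (0 : ℝ) 1, ∫⁻ x : E, ‖fderiv ℝ φ (x + t • h)‖ₑ * ‖h‖ₑ ∂μ := by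
        refine lintegral_lintegral_swap (Measurable.aemeasurable ?_)
        refine Measurable.mul_const ?_ _
        exact (hc.comp (by fun_prop : Continuous fun p : E × ℝ => p.1 + p.2 • h)).enorm.measurable
    _ = ∫⁻ _ : ℝ in Set.Ioc 0 1, (∫⁻ x, ‖fderiv ℝ φ x‖ₑ ∂μ) * ‖h‖ₑ := by
        refine lintegral_congr fun t => ?_
        rw [lintegral_mul_const' _ _ enorm_ne_top]
        congr 1
        exact lintegral_add_right_eq_self (fun x => ‖fderiv ℝ φ x‖ₑ) (t • h)
    _ = (∫⁻ x, ‖fderiv ℝ φ x‖ₑ ∂μ) * ‖h‖ₑ := by simp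

/-- The Poincaré inequality in `L¹`. -/
theorem exists_poincare (hn : 1 ≤ n) (hΩ : IsOpen Ω) (hΩb : Bornology.IsBounded Ω) :
    ∃ C : ℝ, 0 < C ∧ ∀ φ : EuclideanSpace ℝ (Fin n) → ℝ, IsTestFunction Ω φ →
      ∫⁻ x in Ω, ‖φ x‖ₑ ≤ (∫⁻ x in Ω, ‖gradient φ x‖ₑ) * ENNReal.ofReal C := by
  obtain ⟨r, hr, hΩr⟩ := hΩb.exists_pos_norm_le
  -- A shift longer than `2 * r` moves every point of `Ω` out of `Ω`, so on `Ω` the increment of `φ`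
  -- along `e` is `-φ`.
  let e : EuclideanSpace ℝ (Fin n) := EuclideanSpace.single ⟨0, hn⟩ (3 * r)
  have he : ‖e‖ = 3 * r := by simp [e, abs_of_pos hr]
  refine ⟨3 * r, by positivity, fun φ hφ => ?_⟩
  have hz : ∀ x, x ∉ Ω → φ x = 0 := fun x hx =>
    image_eq_zero_of_notMem_tsupport fun hx' => hx (hφ.supp_subset hx')
  calc ∫⁻ x in Ω, ‖φ x‖ₑ ≤ ∫⁻ x, ‖φ (x + e) - φ x‖ₑ := by
        refine (setLIntegral_mono' hΩ.measurableSet fun x hx => ?_).trans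
          (setLIntegral_le_lintegral _ _)
        have hxe : x + e ∉ Ω := fun hmem => by
          have h1 := hΩr _ hmem
          have h2 := hΩr _ hx
          have h3 := norm_sub_le (x + e) x
          rw [add_sub_cancel_left, he] at h3
          linarith
        rw [hz _ hxe, zero_sub, enorm_neg]
    _ ≤ (∫⁻ x, ‖fderiv ℝ φ x‖ₑ) * ‖e‖ₑ :=
        lintegral_enorm_translate_sub_le volume (hφ.smooth.of_le (by simp)) e
    _ = (∫⁻ x in Ω, ‖gradient φ x‖ₑ) * ENNReal.ofReal (3 * r) := by
        have h1 : ∀ x, ‖gradient φ x‖ₑ = ‖fderiv ℝ φ x‖ₑ := fun x => by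
          rw [← ofReal_norm, ← ofReal_norm, norm_gradient]
        rw [← ofReal_norm e, he]
        simp only [h1]
        congr 1
        refine (setLIntegral_eq_of_support_subset ?_).symm
        intro x hx
        refine hφ.supp_subset (tsupport_fderiv_subset ℝ (subset_tsupport _ ?_))
        intro h0
        refine hx ?_
        change ‖fderiv ℝ φ x‖ₑ = 0
        rw [← ofReal_norm, h0, norm_zero, ENNReal.ofReal_zero]

/-- Apply `t ≤ 1 + G(t) / G(1)` to `‖f‖ / ε`. On a space of finite measure, a small Luxemburg norm
thus forces a small `L¹` norm. -/
theorem GrowthBounds.lintegral_enorm_le {α F : Type*} [MeasurableSpace α] [NormedAddCommGroup F]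
    [NormedSpace ℝ F] {G g : ℝ → ℝ} {pm pp : ℝ} {ν : Measure α} {f : α → F}
    (hG : IsYoungFunction G g) (hp : GrowthBounds G g pm pp) (hf : MemOrlicz G ν f) {ε : ℝ}
    (h : luxemburg G ν f < ε) :
    ∫⁻ x, ‖f x‖ₑ ∂ν ≤ ENNReal.ofReal ε * (ν Set.univ + ENNReal.ofReal (G 1)⁻¹) := by
  have hε : 0 < ε := luxemburg_nonneg.trans_lt h
  have h1 := hp.G_pos hG one_pos
  have hm := hp.modular_le_one_of_luxemburg_lt hG hf.2 h
  calc ∫⁻ x, ‖f x‖ₑ ∂ν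
      ≤ ∫⁻ x, ENNReal.ofReal ε *
          (1 + ENNReal.ofReal (G 1)⁻¹ * ENNReal.ofReal (G ‖ε⁻¹ • f x‖)) ∂ν := by
        refine lintegral_mono fun x => ?_
        have h2 := hp.le_add hG (norm_nonneg (ε⁻¹ • f x))
        have h3 : ‖f x‖ = ε * ‖ε⁻¹ • f x‖ := by
          rw [norm_smul, norm_inv, Real.norm_of_nonneg hε.le, mul_inv_cancel_left₀ hε.ne']
        rw [← ofReal_norm, h3, ENNReal.ofReal_mul hε.le, ← ENNReal.ofReal_one,
          ← ENNReal.ofReal_mul (inv_nonneg.2 h1.le), ← ENNReal.ofReal_add zero_le_one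
            (mul_nonneg (inv_nonneg.2 h1.le) (hG.nonneg _ (norm_nonneg _)))]
        gcongr
    _ = ENNReal.ofReal ε * (ν Set.univ + ENNReal.ofReal (G 1)⁻¹ *
          modular G ν (fun x => ε⁻¹ • f x)) := by
        rw [lintegral_const_mul' _ _ ENNReal.ofReal_ne_top, lintegral_add_left measurable_const,
          lintegral_const_mul' _ _ ENNReal.ofReal_ne_top, lintegral_const, one_mul]
        rfl
    _ ≤ _ := by
        gcongr
        exact mul_le_of_le_one_right zero_le hm

theorem IsYoungFunction.memOrlicz_of_bound {α F : Type*} [MeasurableSpace α]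
    [NormedAddCommGroup F] {G g : ℝ → ℝ} {ν : Measure α} [IsFiniteMeasure ν] {f : α → F}
    (hG : IsYoungFunction G g) (hf : AEStronglyMeasurable f ν) {C : ℝ} (hC : ∀ x, ‖f x‖ ≤ C) :
    MemOrlicz G ν f := by
  refine ⟨hf, ?_⟩
  calc modular G ν f ≤ ∫⁻ _, ENNReal.ofReal (G C) ∂ν :=
        lintegral_mono fun x => ENNReal.ofReal_le_ofReal (hG.mono (norm_nonneg _)
          ((norm_nonneg _).trans (hC x)) (hC x))
    _ < ⊤ := by
        rw [lintegral_const]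
        exact ENNReal.mul_lt_top ENNReal.ofReal_lt_top (measure_lt_top _ _)

theorem MemW0.exists_weakGrad {G : ℝ → ℝ} (hu : MemW0 G 1 Ω u) :
    ∃ F, IsWeakGradient Ω u F ∧ MemOrlicz G (volume.restrict Ω) F := by
  have := hu.finiteEnergy
  rwa [HasFiniteEnergy, if_pos rfl] at this

theorem MemW0.isWeakGradient {G : ℝ → ℝ} (hu : MemW0 G 1 Ω u) :
    IsWeakGradient Ω u (weakGrad Ω u) :=
  hu.exists_weakGrad.choose_spec.1.weakGrad

theorem MemW0.memOrlicz_weakGrad {G : ℝ → ℝ} (hΩ : IsOpen Ω) (hu : MemW0 G 1 Ω u) :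
    MemOrlicz G (volume.restrict Ω) (weakGrad Ω u) := by
  obtain ⟨F, hF, hFO⟩ := hu.exists_weakGrad
  exact hFO.congr_ae (hF.weakGrad_ae_eq hΩ).symm

theorem MemW0.ae_eq_zero {G : ℝ → ℝ} {s : ℝ} (hΩ : IsOpen Ω) (hu : MemW0 G s Ω u)
    (h : u =ᵐ[volume.restrict Ω] 0) : ∀ᵐ x, u x = 0 := by
  have h1 := hu.ae_zero
  rw [EventuallyEq, ae_restrict_iff' hΩ.measurableSet] at h
  rw [ae_restrict_iff' hΩ.measurableSet.compl] at h1
  filter_upwards [h, h1] with x hx hx1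
  by_cases hm : x ∈ Ω
  · exact hx hm
  · exact hx1 hm

/-- A function in `W^{1,G}_0(Ω)` whose weak gradient vanishes is zero. -/
theorem MemW0.ae_eq_zero_of_weakGrad {G g : ℝ → ℝ} {pm pp : ℝ} (hG : IsYoungFunction G g)
    (hp : GrowthBounds G g pm pp) (hn : 1 ≤ n) (hΩ : IsOpen Ω) (hΩb : Bornology.IsBounded Ω)
    (hu : MemW0 G 1 Ω u) (h0 : weakGrad Ω u =ᵐ[volume.restrict Ω] 0) : ∀ᵐ x, u x = 0 := by
  have hfin : IsFiniteMeasure ((volume : Measure (EuclideanSpace ℝ (Fin n))).restrict Ω) :=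
    ⟨by rw [Measure.restrict_apply_univ]; exact hΩb.measure_lt_top⟩
  obtain ⟨C, hC, hpoin⟩ := exists_poincare hn hΩ hΩb
  set ν := (volume : Measure (EuclideanSpace ℝ (Fin n))).restrict Ω with hν
  set A := ν Set.univ + ENNReal.ofReal (G 1)⁻¹ with hA
  have hAfin : A ≠ ⊤ := (ENNReal.add_lt_top.2 ⟨measure_lt_top _ _, ENNReal.ofReal_lt_top⟩).ne
  -- Since `∇u = 0`, the gradient of `u - φ` is `-∇φ`. Closeness of `φ` to `u` therefore makes `∇φ`
  -- small in `L¹`, hence `φ` by Poincaré, hence `u`.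
  have key : ∀ ε : ℝ, 0 < ε →
      ∫⁻ x, ‖u x‖ₑ ∂ν ≤ ENNReal.ofReal ε * (A + A * ENNReal.ofReal C) := by
    intro ε hε
    obtain ⟨φ, hφ, hlt⟩ := hu.approx ε hε
    have hgc := continuous_gradient_of_fderiv hφ.continuous_fderiv
    have hg : MemOrlicz G ν (gradient φ) := by
      obtain ⟨B, hB⟩ := hφ.continuous_fderiv.bounded_above_of_compact_support
        (hφ.compact_supp.fderiv ℝ)
      exact hG.memOrlicz_of_bound hgc.aestronglyMeasurable
        fun x => (norm_gradient φ x).trans_le (hB x)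
    have hφO : MemOrlicz G ν φ := by
      obtain ⟨B, hB⟩ := hφ.smooth.continuous.bounded_above_of_compact_support hφ.compact_supp
      exact hG.memOrlicz_of_bound hφ.smooth.continuous.aestronglyMeasurable hB
    have hdiff : u - φ = u + (-1 : ℝ) • φ := by
      rw [neg_one_smul, sub_eq_add_neg]
    have hdO : MemOrlicz G ν (u - φ) := by
      rw [hdiff]
      exact hp.memOrlicz_add hG hu.memOrlicz (hp.memOrlicz_smul hG hφO (-1))
    have hwg : weakGrad Ω (u - φ) =ᵐ[ν] fun x => (-1 : ℝ) • gradient φ x := by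
      have h1 := (hu.isWeakGradient.add (hφ.isWeakGradient_gradient.smul (-1))).weakGrad_ae_eq hΩ
      rw [← hdiff] at h1
      filter_upwards [h1, h0] with x hx hx0
      rw [hx, Pi.add_apply, hx0, Pi.smul_apply, Pi.zero_apply, zero_add]
    unfold normW energy normG at hlt
    rw [if_pos rfl, luxemburg_congr_ae hwg, luxemburg_smul (by norm_num), abs_neg, abs_one,
      one_mul] at hlt
    have hl1 : luxemburg G ν (u - φ) < ε :=
      (le_add_of_nonneg_right luxemburg_nonneg).trans_lt hlt
    have hl2 : luxemburg G ν (gradient φ) < ε :=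
      (le_add_of_nonneg_left luxemburg_nonneg).trans_lt hlt
    calc ∫⁻ x, ‖u x‖ₑ ∂ν ≤ ∫⁻ x, (‖(u - φ) x‖ₑ + ‖φ x‖ₑ) ∂ν := by
          refine lintegral_mono fun x => ?_
          have : u x = (u - φ) x + φ x := by simp
          conv_lhs => rw [this]
          exact enorm_add_le _ _
      _ = ∫⁻ x, ‖(u - φ) x‖ₑ ∂ν + ∫⁻ x, ‖φ x‖ₑ ∂ν := lintegral_add_left' hdO.1.enorm _
      _ ≤ ENNReal.ofReal ε * A + ENNReal.ofReal ε * A * ENNReal.ofReal C := by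
          refine add_le_add (hp.lintegral_enorm_le hG hdO hl1) ((hpoin φ hφ).trans ?_)
          gcongr
          exact hp.lintegral_enorm_le hG hg hl2
      _ = _ := by ring
  have hzero : ∫⁻ x, ‖u x‖ₑ ∂ν = 0 := by
    refine le_antisymm ?_ zero_le
    have hlim : Tendsto (fun ε : ℝ => ENNReal.ofReal ε * (A + A * ENNReal.ofReal C)) (𝓝[>] 0)
        (𝓝 (0 * (A + A * ENNReal.ofReal C))) := by
      refine ENNReal.Tendsto.mul_const ?_ (Or.inr ?_)
      · have := ENNReal.continuous_ofReal.tendsto 0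
        rw [ENNReal.ofReal_zero] at this
        exact this.mono_left nhdsWithin_le_nhds
      · exact ENNReal.add_ne_top.2 ⟨hAfin, ENNReal.mul_ne_top hAfin ENNReal.ofReal_ne_top⟩
    rw [zero_mul] at hlim
    refine ge_of_tendsto hlim ?_
    filter_upwards [self_mem_nhdsWithin] with ε hε
    exact key ε hε
  refine hu.ae_eq_zero hΩ ?_
  have := (lintegral_eq_zero_iff' hu.memOrlicz.1.enorm).1 hzero
  filter_upwards [this] with x hx
  simpa using hx

end WeakGradient

/-! ### Hölder quotients -/

section Fractional

open MeasureTheory Filter Topology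

variable {n : ℕ} {Ω : Set (EuclideanSpace ℝ (Fin n))} {u v : EuclideanSpace ℝ (Fin n) → ℝ}
  {G g : ℝ → ℝ} {pm pp s : ℝ}

theorem holderQuot_add (p : EuclideanSpace ℝ (Fin n) × EuclideanSpace ℝ (Fin n)) :
    holderQuot s (u + v) p = holderQuot s u p + holderQuot s v p := by
  simp only [holderQuot, Pi.add_apply]
  ring

theorem holderQuot_smul (c : ℝ) (p : EuclideanSpace ℝ (Fin n) × EuclideanSpace ℝ (Fin n)) :
    holderQuot s (c • u) p = c • holderQuot s u p := by
  simp only [holderQuot, Pi.smul_apply, smul_eq_mul]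
  ring

theorem aestronglyMeasurable_holderQuot (hu : AEStronglyMeasurable u volume) (c : ℝ≥0∞) :
    AEStronglyMeasurable (holderQuot s u) (c • gagliardoMeasure n) := by
  refine AEStronglyMeasurable.smul_measure (AEStronglyMeasurable.mono_ac
    (withDensity_absolutelyContinuous _ _) ?_) _
  have h1 : AEMeasurable (fun p : EuclideanSpace ℝ (Fin n) × EuclideanSpace ℝ (Fin n) =>
      u p.1 - u p.2) volume :=
    (hu.aemeasurable.comp_quasiMeasurePreserving Measure.quasiMeasurePreserving_fst).sub
      (hu.aemeasurable.comp_quasiMeasurePreserving Measure.quasiMeasurePreserving_snd)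
  have h2 : Measurable (fun p : EuclideanSpace ℝ (Fin n) × EuclideanSpace ℝ (Fin n) =>
      ‖p.1 - p.2‖ ^ s) := by fun_prop
  exact (h1.div h2.aemeasurable).aestronglyMeasurable

theorem MemW0.memOrlicz_holderQuot (hs : s ≠ 1) (hu : MemW0 G s Ω u) :
    MemOrlicz G (ENNReal.ofReal (1 - s) • gagliardoMeasure n) (holderQuot s u) := by
  refine ⟨aestronglyMeasurable_holderQuot hu.aesm _, ?_⟩
  have := hu.finiteEnergy
  rwa [HasFiniteEnergy, if_neg hs] at this

/-- A function in `W^{s,G}_0(Ω)` whose Hölder quotient vanishes is zero. -/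
theorem MemW0.ae_eq_zero_of_holderQuot (hs : s < 1) (hn : 1 ≤ n)
    (hΩb : Bornology.IsBounded Ω) (hu : MemW0 G s Ω u)
    (h0 : holderQuot s u =ᵐ[ENNReal.ofReal (1 - s) • gagliardoMeasure n] 0) :
    ∀ᵐ x, u x = 0 := by
  have h1 : ∀ᵐ p ∂(gagliardoMeasure n), holderQuot s u p = 0 :=
    (Measure.ae_ennreal_smul_measure_iff (by simpa using hs)).1 h0
  rw [gagliardoMeasure, ae_withDensity_iff (by fun_prop)] at h1
  -- Off the diagonal the density and the denominator are positive; on it the equality is trivial.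
  have h2 : ∀ᵐ p : EuclideanSpace ℝ (Fin n) × EuclideanSpace ℝ (Fin n)
      ∂((volume : Measure (EuclideanSpace ℝ (Fin n))).prod volume), u p.1 = u p.2 := by
    rw [← Measure.volume_eq_prod]
    filter_upwards [h1] with p hp
    by_cases hne : p.1 = p.2
    · rw [hne]
    · have hpos : 0 < ‖p.1 - p.2‖ := norm_pos_iff.2 (sub_ne_zero.2 hne)
      have h3 := hp (ENNReal.ofReal_pos.2 (by positivity)).ne'
      rw [holderQuot, div_eq_zero_iff] at h3
      rcases h3 with h3 | h3
      · exact sub_eq_zero.1 h3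
      · exact absurd h3 (Real.rpow_pos_of_pos hpos s).ne'
  have : Nonempty (Fin n) := ⟨⟨0, hn⟩⟩
  -- The whole space has infinite measure, as `n ≥ 1`, while `Ω` is bounded. So almost every `x` can
  -- be compared with some `y` at which `u` vanishes.
  have hne : (volume : Measure (EuclideanSpace ℝ (Fin n))).restrict Ωᶜ ≠ 0 := by
    rw [Ne, Measure.restrict_eq_zero]
    intro hc
    have h3 := measure_univ_of_isAddLeftInvariant
      (volume : Measure (EuclideanSpace ℝ (Fin n)))
    have h4 := measure_union_le (μ := (volume : Measure (EuclideanSpace ℝ (Fin n)))) Ω Ωᶜ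
    rw [Set.union_compl_self, h3, hc, add_zero, top_le_iff] at h4
    exact hΩb.measure_lt_top.ne h4
  have : NeBot (ae ((volume : Measure (EuclideanSpace ℝ (Fin n))).restrict Ωᶜ)) :=
    ae_neBot.2 hne
  filter_upwards [Measure.ae_ae_of_ae_prod h2] with x hx
  obtain ⟨y, hy, hy'⟩ := ((ae_restrict_of_ae hx).and hu.ae_zero).exists
  exact hy.trans hy'

end Fractional

/-! ### Homogeneity of the norm and of the space -/

section Scaling

open MeasureTheory Filter Topology

variable {n : ℕ} {Ω : Set (EuclideanSpace ℝ (Fin n))} {u v : EuclideanSpace ℝ (Fin n) → ℝ}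
  {G g : ℝ → ℝ} {pm pp s : ℝ}

/-- Only a weak gradient is assumed, not membership in the space, because `MemW0.smul` applies this
to `v - φ` with `φ` a test function. -/
theorem normW_smul (hΩ : IsOpen Ω) (h : s = 1 → ∃ F, IsWeakGradient Ω v F) {c : ℝ} (hc : c ≠ 0) :
    normW G s Ω (c • v) = |c| * normW G s Ω v := by
  have h1 : normG G Ω (c • v) = |c| * normG G Ω v := luxemburg_smul hc
  have h2 : energy G s Ω (c • v) = |c| * energy G s Ω v := by
    unfold energy
    split_ifs with hs
    · obtain ⟨F, hF⟩ := h hs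
      have h3 : weakGrad Ω (c • v) =ᵐ[volume.restrict Ω] fun x => c • weakGrad Ω v x :=
        (hF.weakGrad.smul c).weakGrad_ae_eq hΩ
      rw [luxemburg_congr_ae h3, luxemburg_smul hc]
    · unfold gagliardo
      rw [← luxemburg_smul hc]
      congr 1
      ext p
      exact holderQuot_smul c p
  unfold normW
  rw [h1, h2, mul_add]

theorem MemW0.normW_smul (hΩ : IsOpen Ω) (hv : MemW0 G s Ω v) {c : ℝ} (hc : c ≠ 0) :
    normW G s Ω (c • v) = |c| * normW G s Ω v :=
  FracOrlicz.normW_smul hΩ (fun hs => by subst hs; exact ⟨_, hv.isWeakGradient⟩) hc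

theorem IsTestFunction.smul {φ : EuclideanSpace ℝ (Fin n) → ℝ} (hφ : IsTestFunction Ω φ)
    (c : ℝ) : IsTestFunction Ω (c • φ) where
  smooth := hφ.smooth.const_smul c
  compact_supp := hφ.compact_supp.smul_left (f := fun _ => c)
  supp_subset := (tsupport_smul_subset_right (fun _ => c) φ).trans hφ.supp_subset

theorem MemW0.smul (hG : IsYoungFunction G g) (hp : GrowthBounds G g pm pp) (hΩ : IsOpen Ω)
    (hv : MemW0 G s Ω v) {c : ℝ} (hc : c ≠ 0) : MemW0 G s Ω (c • v) where
  aesm := hv.aesm.const_smul c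
  ae_zero := by
    filter_upwards [hv.ae_zero] with x hx
    rw [Pi.smul_apply, hx, smul_zero]
  memOrlicz := hp.memOrlicz_smul hG hv.memOrlicz c
  finiteEnergy := by
    unfold HasFiniteEnergy
    split_ifs with hs
    · subst hs
      obtain ⟨F, hF, hFO⟩ := hv.exists_weakGrad
      exact ⟨c • F, hF.smul c, hp.memOrlicz_smul hG hFO c⟩
    · have h := (hp.memOrlicz_smul hG (hv.memOrlicz_holderQuot hs) c).2
      simp only [← holderQuot_smul] at h
      exact h
  approx ε hε := by
    have hc' : 0 < |c| := abs_pos.2 hc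
    obtain ⟨φ, hφ, hlt⟩ := hv.approx (ε / |c|) (by positivity)
    refine ⟨c • φ, hφ.smul c, ?_⟩
    rw [← smul_sub, FracOrlicz.normW_smul hΩ _ hc]
    · rwa [lt_div_iff₀ hc', mul_comm] at hlt
    · intro hs
      subst hs
      refine ⟨weakGrad Ω v + (-1 : ℝ) • gradient φ, ?_⟩
      have := hv.isWeakGradient.add (hφ.isWeakGradient_gradient.smul (-1))
      rwa [neg_one_smul, ← sub_eq_add_neg] at this

end Scaling

/-! ### Critical points and the abstract Euler–Lagrange equation -/

section CriticalPoint

open MeasureTheory Filter Topology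

variable {n : ℕ} {Ω : Set (EuclideanSpace ℝ (Fin n))} {u v : EuclideanSpace ℝ (Fin n) → ℝ}
  {G g : ℝ → ℝ} {pm pp s : ℝ} {α F : Type*} [MeasurableSpace α] [NormedAddCommGroup F]
  [InnerProductSpace ℝ F] {ν : Measure α} {D : (EuclideanSpace ℝ (Fin n) → ℝ) → α → F}

/-- `D` maps `W^{s,G}_0(Ω)` linearly, up to null sets, to the Orlicz space of `ν`, and `D u ≠ 0`. -/
structure OrliczRealization (G : ℝ → ℝ) (s : ℝ) (Ω : Set (EuclideanSpace ℝ (Fin n)))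
    (u : EuclideanSpace ℝ (Fin n) → ℝ) (ν : Measure α)
    (D : (EuclideanSpace ℝ (Fin n) → ℝ) → α → F) : Prop where
  mem : ∀ v, MemW0 G s Ω v → MemOrlicz G ν (D v)
  add : ∀ v, MemW0 G s Ω v → D (u + v) =ᵐ[ν] fun x => D u x + D v x
  smul : ∀ v, MemW0 G s Ω v → ∀ c : ℝ, D (c • v) =ᵐ[ν] fun x => c • D v x
  ne_zero : ¬ D u =ᵐ[ν] 0

theorem luxemburgDeriv_congr {f h h' : α → F} (hh : h =ᵐ[ν] h') :
    luxemburgDeriv G g ν f h = luxemburgDeriv G g ν f h' := by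
  unfold luxemburgDeriv
  congr 1
  exact integral_congr_ae (hh.mono fun x hx => by simp only [hx])

theorem OrliczRealization.luxemburgDeriv_smul (hD : OrliczRealization G s Ω u ν D)
    (hv : MemW0 G s Ω v) (c : ℝ) : luxemburgDeriv G g ν (D u) (D (c • v)) =
      c * luxemburgDeriv G g ν (D u) (D v) := by
  rw [luxemburgDeriv_congr (hD.smul v hv c), FracOrlicz.luxemburgDeriv_smul]

theorem OrliczRealization.frechet (hG : IsYoungFunction G g) (hp : GrowthBounds G g pm pp)
    (hu : MemW0 G s Ω u) (hD : OrliczRealization G s Ω u ν D)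
    (hle : ∀ v, luxemburg G ν (D v) ≤ normW G s Ω v) {ε : ℝ} (hε : 0 < ε) :
    ∃ δ, 0 < δ ∧ ∀ v, MemW0 G s Ω v → normW G s Ω v < δ →
      |luxemburg G ν (D (u + v)) - luxemburg G ν (D u) - luxemburgDeriv G g ν (D u) (D v)| ≤
        ε * normW G s Ω v := by
  obtain ⟨δ, hδ, H⟩ := hp.luxemburg_frechet hG (hD.mem u hu) hD.ne_zero hε
  refine ⟨δ, hδ, fun v hv hvδ => ?_⟩
  rw [luxemburg_congr_ae (hD.add v hv)]
  exact H _ (hD.mem v hv) _ (hle v) hvδ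

theorem OrliczRealization.abs_luxemburgDeriv_le (hG : IsYoungFunction G g)
    (hp : GrowthBounds G g pm pp) (hu : MemW0 G s Ω u) (hD : OrliczRealization G s Ω u ν D)
    (hle : ∀ v, luxemburg G ν (D v) ≤ normW G s Ω v) :
    ∃ C, 0 ≤ C ∧ ∀ v, MemW0 G s Ω v →
      |luxemburgDeriv G g ν (D u) (D v)| ≤ C * normW G s Ω v := by
  obtain ⟨C, hC, H⟩ := hp.abs_luxemburgDeriv_le hG (hD.mem u hu) hD.ne_zero
  exact ⟨C, hC, fun v hv => H _ (hD.mem v hv) _ (hle v)⟩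

/-- The derivative of the Luxemburg norm in terms of the pairing. -/
theorem OrliczRealization.luxemburgDeriv_eq (hG : IsYoungFunction G g)
    (hp : GrowthBounds G g pm pp) (hu : MemW0 G s Ω u) (hD : OrliczRealization G s Ω u ν D) :
    ∃ a : ℝ, 0 < a ∧
      ∫ x, gradPair g ((luxemburg G ν (D u))⁻¹ • D u x) (D u x) ∂ν = luxemburg G ν (D u) * a ∧
      ∀ v, luxemburgDeriv G g ν (D u) (D v) =
        (∫ x, gradPair g ((luxemburg G ν (D u))⁻¹ • D u x) (D v x) ∂ν) / a := by
  have hN := hp.luxemburg_pos hG (hD.mem u hu) hD.ne_zero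
  refine ⟨_, hp.integral_gradPair_self_pos hG (hp.memOrlicz_smul hG (hD.mem u hu) _)
    (hp.modular_luxemburg hG (hD.mem u hu) hD.ne_zero), ?_, fun v => rfl⟩
  simp only [gradPair_smul]
  rw [integral_const_mul, mul_inv_cancel_left₀ hN.ne']

/-- The quotient rule for first-order expansions. Of the linearity of `A` and `B` only homogeneity
enters, to pass from `v` to `t • v`. -/
theorem isCriticalPoint_iff_deriv {A B : (EuclideanSpace ℝ (Fin n) → ℝ) → ℝ}
    (hG : IsYoungFunction G g) (hp : GrowthBounds G g pm pp) (hΩ : IsOpen Ω)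
    (hH : 0 < energy G s Ω u) (hN : 0 < normG G Ω u)
    (hA : ∀ v, MemW0 G s Ω v → ∀ c : ℝ, A (c • v) = c * A v)
    (hB : ∀ v, MemW0 G s Ω v → ∀ c : ℝ, B (c • v) = c * B v)
    (hbB : ∃ C, 0 ≤ C ∧ ∀ v, MemW0 G s Ω v → |B v| ≤ C * normW G s Ω v)
    (hdA : ∀ ε, 0 < ε → ∃ δ, 0 < δ ∧ ∀ v, MemW0 G s Ω v → normW G s Ω v < δ →
      |energy G s Ω (u + v) - energy G s Ω u - A v| ≤ ε * normW G s Ω v)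
    (hdB : ∀ ε, 0 < ε → ∃ δ, 0 < δ ∧ ∀ v, MemW0 G s Ω v → normW G s Ω v < δ →
      |normG G Ω (u + v) - normG G Ω u - B v| ≤ ε * normW G s Ω v) :
    IsCriticalPoint G s Ω u ↔
      ∀ v, MemW0 G s Ω v → normG G Ω u * A v = energy G s Ω u * B v := by
  set H := energy G s Ω u with hHdef
  set N := normG G Ω u with hNdef
  have hnorm : ∀ v, 0 ≤ normW G s Ω v := fun v => by
    unfold normW normG energy gagliardo
    split_ifs <;> exact add_nonneg luxemburg_nonneg luxemburg_nonneg
  obtain ⟨C, hC, hbB⟩ := hbB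
  obtain ⟨δ₁, hδ₁, hd₁⟩ := hdB 1 one_pos
  -- The denominator changes by at most `(1 + C) * normW v`, which is below `N / 2`.
  have hNbound : ∀ v, MemW0 G s Ω v → normW G s Ω v < min δ₁ (N / (2 * (C + 1))) →
      N / 2 ≤ normG G Ω (u + v) ∧ normG G Ω (u + v) ≤ 2 * N := by
    intro v hv hlt
    have h1 := abs_le.1 (hd₁ v hv (hlt.trans_le (min_le_left _ _)))
    have h2 := abs_le.1 (hbB v hv)
    have h3 := hlt.trans_le (min_le_right _ _)
    rw [lt_div_iff₀ (by positivity)] at h3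
    constructor <;> linarith [h1.1, h1.2, h2.1, h2.2]
  have hrel : ∀ v, normG G Ω (u + v) ≠ 0 →
      (rayleigh G s Ω (u + v) - rayleigh G s Ω u) * (N * normG G Ω (u + v)) =
        N * (energy G s Ω (u + v) - H - A v) - H * (normG G Ω (u + v) - N - B v) +
          (N * A v - H * B v) := by
    intro v hv
    unfold rayleigh
    rw [← hHdef, ← hNdef]
    field_simp
    ring
  constructor
  · intro hcrit v hv
    have hW := hnorm v
    have key : ∀ η : ℝ, 0 < η →
        |N * A v - H * B v| ≤ η * (normW G s Ω v * (N * (2 * N) + N + H)) := by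
      intro η hη
      obtain ⟨a₁, ha₁, h₁⟩ := hcrit η hη
      obtain ⟨a₂, ha₂, h₂⟩ := hdA η hη
      obtain ⟨a₃, ha₃, h₃⟩ := hdB η hη
      set a := min (min a₁ a₂) (min a₃ (min δ₁ (N / (2 * (C + 1))))) with ha
      have ha0 : 0 < a := by positivity
      -- The summand `1` covers directions of zero norm.
      set t := a / (normW G s Ω v + 1) with ht
      have ht0 : 0 < t := by positivity
      have hW' : normW G s Ω (t • v) = t * normW G s Ω v := by
        rw [hv.normW_smul hΩ ht0.ne', abs_of_pos ht0]
      have hlt : normW G s Ω (t • v) < a := by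
        rw [hW', ht, div_mul_eq_mul_div, div_lt_iff₀ (by positivity)]
        linarith
      have hv' := hv.smul hG hp hΩ ht0.ne'
      have k₁ := h₁ _ hv' (hlt.trans_le ((min_le_left _ _).trans (min_le_left _ _)))
      have k₂ := h₂ _ hv' (hlt.trans_le ((min_le_left _ _).trans (min_le_right _ _)))
      have k₃ := h₃ _ hv' (hlt.trans_le ((min_le_right _ _).trans (min_le_left _ _)))
      obtain ⟨k₄, k₅⟩ := hNbound _ hv'
        (hlt.trans_le ((min_le_right _ _).trans (min_le_right _ _)))
      have hN' : 0 < normG G Ω (u + t • v) := by linarith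
      have e := hrel _ hN'.ne'
      rw [hA v hv] at e k₂
      rw [hB v hv] at e k₃
      rw [hW'] at k₁ k₂ k₃
      have e2 : t * (N * A v - H * B v) =
          (rayleigh G s Ω (u + t • v) - rayleigh G s Ω u) * (N * normG G Ω (u + t • v)) -
            N * (energy G s Ω (u + t • v) - H - t * A v) +
            H * (normG G Ω (u + t • v) - N - t * B v) := by
        rw [e]; ring
      have hηt : 0 ≤ η * (t * normW G s Ω v) := by positivity
      have b1 : |(rayleigh G s Ω (u + t • v) - rayleigh G s Ω u) *
          (N * normG G Ω (u + t • v))| ≤ η * (t * normW G s Ω v) * (N * (2 * N)) := by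
        rw [abs_mul, abs_of_pos (mul_pos hN hN')]
        gcongr
      have b2 : |N * (energy G s Ω (u + t • v) - H - t * A v)| ≤
          N * (η * (t * normW G s Ω v)) := by
        rw [abs_mul, abs_of_pos hN]
        gcongr
      have b3 : |H * (normG G Ω (u + t • v) - N - t * B v)| ≤
          H * (η * (t * normW G s Ω v)) := by
        rw [abs_mul, abs_of_pos hH]
        gcongr
      have b4 : t * |N * A v - H * B v| ≤
          t * (η * (normW G s Ω v * (N * (2 * N) + N + H))) := by
        have e3 : t * |N * A v - H * B v| = |t * (N * A v - H * B v)| := by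
          rw [abs_mul, abs_of_pos ht0]
        rw [e3, e2]
        refine (abs_add_le _ _).trans ((add_le_add_left (abs_sub _ _) _).trans ?_)
        linarith
      exact le_of_mul_le_mul_left b4 ht0
    have hlim : Tendsto (fun η : ℝ => η * (normW G s Ω v * (N * (2 * N) + N + H))) (𝓝[>] 0)
        (𝓝 (0 * (normW G s Ω v * (N * (2 * N) + N + H)))) :=
      (tendsto_id.mul_const _).mono_left nhdsWithin_le_nhds
    rw [zero_mul] at hlim
    have h0 : |N * A v - H * B v| ≤ 0 := by
      refine ge_of_tendsto hlim ?_
      filter_upwards [self_mem_nhdsWithin] with η hη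
      exact key η hη
    exact sub_eq_zero.1 (abs_nonpos_iff.1 h0)
  · intro heq ε hε
    -- With this constant `q` one has `(N + H) * q = ε * N * (N / 2)`, and `N / 2` is a lower bound
    -- for the perturbed denominator.
    obtain ⟨a₂, ha₂, h₂⟩ := hdA (ε * (N / 2) / (1 + H / N)) (by positivity)
    obtain ⟨a₃, ha₃, h₃⟩ := hdB (ε * (N / 2) / (1 + H / N)) (by positivity)
    refine ⟨min (min a₂ a₃) (min δ₁ (N / (2 * (C + 1)))), by positivity, fun v hv hlt => ?_⟩
    have k₂ := h₂ _ hv (hlt.trans_le ((min_le_left _ _).trans (min_le_left _ _)))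
    have k₃ := h₃ _ hv (hlt.trans_le ((min_le_left _ _).trans (min_le_right _ _)))
    obtain ⟨k₄, -⟩ := hNbound _ hv (hlt.trans_le (min_le_right _ _))
    have hN' : 0 < normG G Ω (u + v) := by linarith
    have e := hrel _ hN'.ne'
    rw [heq v hv, sub_self, add_zero] at e
    set W := normW G s Ω v with hWdef
    have hW : 0 ≤ W := hnorm v
    set q := ε * (N / 2) / (1 + H / N) with hq
    have b2 : |N * (energy G s Ω (u + v) - H - A v)| ≤ N * (q * W) := by
      rw [abs_mul, abs_of_pos hN]
      gcongr
    have b3 : |H * (normG G Ω (u + v) - N - B v)| ≤ H * (q * W) := by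
      rw [abs_mul, abs_of_pos hH]
      gcongr
    have b4 : |rayleigh G s Ω (u + v) - rayleigh G s Ω u| * (N * normG G Ω (u + v)) ≤
        ε * W * (N * (N / 2)) := by
      rw [← abs_of_pos (mul_pos hN hN'), ← abs_mul, e]
      refine (abs_sub _ _).trans ((add_le_add b2 b3).trans (le_of_eq ?_))
      rw [hq]
      field_simp
    have b5 : ε * W * (N * (N / 2)) ≤ ε * W * (N * normG G Ω (u + v)) := by gcongr
    exact le_of_mul_le_mul_right (b4.trans b5) (mul_pos hN hN')

/-- The Lagrange multiplier is `H * a / (N * b)`; testing with `w` shows that no other value is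
possible. -/
theorem forall_mul_eq_iff_exists {ι : Type*} {S : ι → Prop} {P R : ι → ℝ} {w : ι}
    {N H a b : ℝ} (hN : 0 < N) (ha : 0 < a) (hb : 0 < b) (hw : S w)
    (hP : P w = H * a) (hR : R w = N * b) :
    (∀ v, S v → N * (P v / a) = H * (R v / b)) ↔ ∃ lam : ℝ, ∀ v, S v → P v = lam * R v := by
  constructor
  · intro h
    refine ⟨H * a / (N * b), fun v hv => ?_⟩
    have h1 := h v hv
    field_simp at h1 ⊢
    linarith
  · rintro ⟨lam, h⟩ v hv
    have h1 := h w hw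
    rw [hP, hR] at h1
    rw [h v hv]
    field_simp
    linear_combination (-R v) * h1

/-- This treats the local and the fractional case at once: all that matters is that the energy is
the Luxemburg norm of a realization `D`. -/
theorem isCriticalPoint_iff_exists_integral_eq (hG : IsYoungFunction G g)
    (hp : GrowthBounds G g pm pp) (hΩ : IsOpen Ω) (hu : MemW0 G s Ω u)
    (hD : OrliczRealization G s Ω u ν D)
    (hI : OrliczRealization G s Ω u (volume.restrict Ω) (fun v => v))
    (henergy : ∀ v, energy G s Ω v = luxemburg G ν (D v)) :
    IsCriticalPoint G s Ω u ↔ ∃ lam : ℝ, ∀ v, MemW0 G s Ω v →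
      ∫ x, gradPair g ((luxemburg G ν (D u))⁻¹ • D u x) (D v x) ∂ν =
        lam * ∫ x in Ω, gradPair g ((normG G Ω u)⁻¹ • u x) (v x) := by
  have hH := hp.luxemburg_pos hG (hD.mem u hu) hD.ne_zero
  have hN := hp.luxemburg_pos hG (hI.mem u hu) hI.ne_zero
  have hle : ∀ v, luxemburg G ν (D v) ≤ normW G s Ω v := fun v => by
    unfold normW
    rw [henergy]
    exact le_add_of_nonneg_left luxemburg_nonneg
  have hle' : ∀ v, normG G Ω v ≤ normW G s Ω v := fun v => by
    unfold normW
    rw [henergy]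
    exact le_add_of_nonneg_right luxemburg_nonneg
  obtain ⟨a, ha, hau, hav⟩ := hD.luxemburgDeriv_eq hG hp hu
  obtain ⟨b, hb, hbu, hbv⟩ := hI.luxemburgDeriv_eq hG hp hu
  have hdA : ∀ ε, 0 < ε → ∃ δ, 0 < δ ∧ ∀ v, MemW0 G s Ω v → normW G s Ω v < δ →
      |energy G s Ω (u + v) - energy G s Ω u - luxemburgDeriv G g ν (D u) (D v)| ≤
        ε * normW G s Ω v := fun ε hε => by
    simp only [henergy]
    exact hD.frechet hG hp hu hle hε
  have hdB : ∀ ε, 0 < ε → ∃ δ, 0 < δ ∧ ∀ v, MemW0 G s Ω v → normW G s Ω v < δ →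
      |normG G Ω (u + v) - normG G Ω u - luxemburgDeriv G g (volume.restrict Ω) u v| ≤
        ε * normW G s Ω v := fun ε hε => hI.frechet hG hp hu hle' hε
  have hbB : ∃ C, 0 ≤ C ∧ ∀ v, MemW0 G s Ω v →
      |luxemburgDeriv G g (volume.restrict Ω) u v| ≤ C * normW G s Ω v := by
    obtain ⟨C, hC, h⟩ := hI.abs_luxemburgDeriv_le hG hp hu hle'
    exact ⟨C, hC, fun v hv => h v hv⟩
  have hsA : ∀ v, MemW0 G s Ω v → ∀ c : ℝ, luxemburgDeriv G g ν (D u) (D (c • v)) =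
      c * luxemburgDeriv G g ν (D u) (D v) := fun v hv c => hD.luxemburgDeriv_smul hv c
  have hsB : ∀ v, MemW0 G s Ω v → ∀ c : ℝ, luxemburgDeriv G g (volume.restrict Ω) u (c • v) =
      c * luxemburgDeriv G g (volume.restrict Ω) u v :=
    fun v hv c => hI.luxemburgDeriv_smul hv c
  have key := isCriticalPoint_iff_deriv (A := fun v => luxemburgDeriv G g ν (D u) (D v))
    (B := fun v => luxemburgDeriv G g (volume.restrict Ω) u v) hG hp hΩ
    ((henergy u).symm ▸ hH) hN hsA hsB hbB hdA hdB
  rw [henergy] at key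
  refine key.trans ?_
  have hiff : (∀ v, MemW0 G s Ω v → normG G Ω u * luxemburgDeriv G g ν (D u) (D v) =
      luxemburg G ν (D u) * luxemburgDeriv G g (volume.restrict Ω) u v) ↔
      ∀ v, MemW0 G s Ω v → normG G Ω u *
        ((∫ x, gradPair g ((luxemburg G ν (D u))⁻¹ • D u x) (D v x) ∂ν) / a) =
      luxemburg G ν (D u) *
        ((∫ x in Ω, gradPair g ((normG G Ω u)⁻¹ • u x) (v x)) / b) :=
    forall₂_congr fun v _ => by rw [hav v, hbv v, normG]
  exact hiff.trans (forall_mul_eq_iff_exists (S := MemW0 G s Ω) hN ha hb hu hau hbu)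

end CriticalPoint

/-! ### The concrete realizations and the main theorem -/

section Main

open MeasureTheory Filter Topology

variable {n : ℕ} {Ω : Set (EuclideanSpace ℝ (Fin n))} {u v : EuclideanSpace ℝ (Fin n) → ℝ}
  {G g : ℝ → ℝ} {pm pp s : ℝ}

theorem gradPair_inv_smul {F : Type*} [NormedAddCommGroup F] [InnerProductSpace ℝ F] {c : ℝ}
    (hc : 0 < c) (a z : F) :
    gradPair g (c⁻¹ • a) z = g (‖a‖ / c) * (inner ℝ a z / ‖a‖) := by
  unfold gradPair
  rw [norm_smul, real_inner_smul_left, Real.norm_of_nonneg (inv_nonneg.2 hc.le),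
    mul_div_mul_left _ _ (inv_ne_zero hc.ne'), ← div_eq_inv_mul]

theorem gradPair_inv_smul_real {c : ℝ} (hc : 0 < c) (a z : ℝ) :
    gradPair g (c⁻¹ • a) z = g (|a| / c) * (a / |a|) * z := by
  rw [gradPair_inv_smul hc, Real.norm_eq_abs, real_inner_eq_re_inner, RCLike.inner_apply]
  simp only [conj_trivial, RCLike.re_to_real]
  ring

theorem MemW0.realization_id (hΩ : IsOpen Ω) (hu : MemW0 G s Ω u) (hu0 : ¬ ∀ᵐ x, u x = 0) :
    OrliczRealization G s Ω u (volume.restrict Ω) (fun v => v) where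
  mem _ hv := hv.memOrlicz
  add _ _ := EventuallyEq.rfl
  smul _ _ _ := EventuallyEq.rfl
  ne_zero h := hu0 (hu.ae_eq_zero hΩ h)

theorem MemW0.realization_weakGrad (hG : IsYoungFunction G g) (hp : GrowthBounds G g pm pp)
    (hn : 1 ≤ n) (hΩ : IsOpen Ω) (hΩb : Bornology.IsBounded Ω) (hu : MemW0 G 1 Ω u)
    (hu0 : ¬ ∀ᵐ x, u x = 0) :
    OrliczRealization G 1 Ω u (volume.restrict Ω) (weakGrad Ω) where
  mem _ hv := hv.memOrlicz_weakGrad hΩ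
  add _ hv := (hu.isWeakGradient.add hv.isWeakGradient).weakGrad_ae_eq hΩ
  smul _ hv c := (hv.isWeakGradient.smul c).weakGrad_ae_eq hΩ
  ne_zero h := hu0 (hu.ae_eq_zero_of_weakGrad hG hp hn hΩ hΩb h)

theorem MemW0.realization_holderQuot (hs : s < 1) (hn : 1 ≤ n) (hΩb : Bornology.IsBounded Ω)
    (hu : MemW0 G s Ω u) (hu0 : ¬ ∀ᵐ x, u x = 0) :
    OrliczRealization G s Ω u (ENNReal.ofReal (1 - s) • gagliardoMeasure n) (holderQuot s) where
  mem _ hv := hv.memOrlicz_holderQuot hs.ne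
  add _ _ := Eventually.of_forall holderQuot_add
  smul _ _ c := Eventually.of_forall (holderQuot_smul c)
  ne_zero h := hu0 (hu.ae_eq_zero_of_holderQuot hs hn hΩb h)

end Main

end FracOrlicz

open FracOrlicz MeasureTheory in
theorem theorem3p1 (n : ℕ) (hn : 1 ≤ n)
    (Ω : Set (EuclideanSpace ℝ (Fin n))) (hΩ : IsOpen Ω) (hΩb : Bornology.IsBounded Ω)
    (G g : ℝ → ℝ) (hG : FracOrlicz.IsYoungFunction G g)
    (pm pp : ℝ) (hp : FracOrlicz.GrowthBounds G g pm pp)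
    (s : ℝ) (hs0 : 0 < s) (hs1 : s ≤ 1)
    (u : EuclideanSpace ℝ (Fin n) → ℝ) (hu : FracOrlicz.MemW0 G s Ω u)
    (hu0 : ¬ (∀ᵐ x ∂(MeasureTheory.volume : MeasureTheory.Measure (EuclideanSpace ℝ (Fin n))),
      u x = 0)) :
    FracOrlicz.IsCriticalPoint G s Ω u ↔ ∃ lam : ℝ, FracOrlicz.IsWeakSolution G g s Ω lam u := by
  have hI := hu.realization_id hΩ hu0
  have hN : 0 < normG G Ω u := hp.luxemburg_pos hG (hI.mem u hu) hI.ne_zero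
  have hrhs : ∀ v x, gradPair g ((normG G Ω u)⁻¹ • u x) (v x) = rhsIntegrand G g Ω u v x :=
    fun v x => gradPair_inv_smul_real hN (u x) (v x)
  -- Absolute convergence holds for every admissible `v`, so only the equality of the integrals
  -- carries content.
  have hrhsInt : ∀ v, MemW0 G s Ω v → Integrable (rhsIntegrand G g Ω u v) (volume.restrict Ω) :=
    fun v hv => (hp.integrable_gradPair hG (hp.memOrlicz_smul hG hu.memOrlicz (normG G Ω u)⁻¹)
      hv.memOrlicz).congr (ae_of_all _ (hrhs v))
  rcases hs1.eq_or_lt with rfl | hs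
  · have hD := hu.realization_weakGrad hG hp hn hΩ hΩb hu0
    have hH := hp.luxemburg_pos hG (hD.mem u hu) hD.ne_zero
    have hl : ∀ v x, gradPair g ((luxemburg G (volume.restrict Ω) (weakGrad Ω u))⁻¹ •
        weakGrad Ω u x) (weakGrad Ω v x) = localIntegrand G g Ω u v x :=
      fun v x => gradPair_inv_smul hH _ _
    rw [isCriticalPoint_iff_exists_integral_eq hG hp hΩ hu hD hI
      (fun v => by rw [energy, if_pos rfl])]
    simp only [hrhs, hl]
    refine exists_congr fun lam => forall₂_congr fun v hv => ?_
    rw [PairingIntegrable, pairing, if_pos rfl, if_pos rfl]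
    refine ⟨fun h => ⟨?_, hrhsInt v hv, h⟩, fun h => h.2.2⟩
    exact (hp.integrable_gradPair hG (hp.memOrlicz_smul hG (hD.mem u hu) _) (hD.mem v hv)).congr
      (ae_of_all _ (hl v))
  · have hD := hu.realization_holderQuot hs hn hΩb hu0
    have hH : 0 < gagliardo G s u := hp.luxemburg_pos hG (hD.mem u hu) hD.ne_zero
    have hl : ∀ v p, gradPair g ((gagliardo G s u)⁻¹ • holderQuot s u p) (holderQuot s v p) =
        fracIntegrand G g s u v p :=
      fun v p => gradPair_inv_smul_real hH _ _
    rw [isCriticalPoint_iff_exists_integral_eq hG hp hΩ hu hD hI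
      (fun v => by rw [energy, if_neg hs.ne]; rfl)]
    change (∃ lam : ℝ, ∀ v, MemW0 G s Ω v → ∫ p, gradPair g ((gagliardo G s u)⁻¹ •
      holderQuot s u p) (holderQuot s v p) ∂(ENNReal.ofReal (1 - s) • gagliardoMeasure n) = _) ↔ _
    simp only [hrhs, hl]
    refine exists_congr fun lam => forall₂_congr fun v hv => ?_
    -- The factor `1 - s` is part of the measure in the modular but stands in front of the integral
    -- in the pairing; being nonzero and finite, it does not affect integrability.
    rw [PairingIntegrable, pairing, if_neg hs.ne, if_neg hs.ne, integral_smul_measure,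
      ENNReal.toReal_ofReal (sub_nonneg.2 hs.le), smul_eq_mul]
    refine ⟨fun h => ⟨?_, hrhsInt v hv, h⟩, fun h => h.2.2⟩
    refine (integrable_smul_measure (c := ENNReal.ofReal (1 - s)) (by simpa using hs)
      ENNReal.ofReal_ne_top).1 ?_
    exact (hp.integrable_gradPair hG (hp.memOrlicz_smul hG (hD.mem u hu) _) (hD.mem v hv)).congr
      (ae_of_all _ (hl v))
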